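/- Fix $\upsilon_1\ge 1$. There are constants $C_1,C_2>0$ depending only on $\upsilon_1$ such that the following holds. Let $n,p$ be natural numbers, $\alpha\in(0,1)$, $\beta^*\in\mathbb R^p$, and let $(X,Y)$ be a random pair with values in $\mathbb R^p\times\mathbb R$ such that the conditional $\alpha$-quantile of $Y$ given $X$ is linear, that is, $Q_\alpha(Y\mid X)=\inf\{y\in\mathbb R: F_{Y\mid X}(y)\ge\alpha\}=X^{\mathsf T}\beta^*$ almost surely. Put $\varepsilon=Y-X^{\mathsf T}\beta^*$. Assume: (a) (sub-Gaussian covariates) $\Sigma=\mathbb E(XX^{\mathsf T})$ is (finite and) positive definite and, with $W=\Sigma^{-1/2}X$, one has $\mathbb P(|u^{\mathsf T}W|\ge \upsilon_1 s)\le 2e^{-s^2/2}$ for all $s\ge 0$ and all $u\in\mathbb R^p$ with $\|u\|_2=1$; (b) (conditional density) the conditional density $f_{\varepsilon\mid X}$ of $\varepsilon$ given $X$ exists and is continuous on its support, and there are constants $\underline f>0$ and $l_0>0$ such that, almost surely over $X$, $f_{\varepsilon\mid X}(0)\ge \underline f$ and $|f_{\varepsilon\mid X}(s)-f_{\varepsilon\mid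 X}(0)|\le l_0|s|$ for all $s\in\mathbb R$. Let $(X_1,Y_1),\dots,(X_n,Y_n)$ be independent copies of $(X,Y)$, and let $\hat\beta$ be the quantile regression estimator, i.e. any $$\hat\beta\in\operatorname*{arg\,min}_{\beta\in\mathbb R^p}\ \frac1n\sum_{i=1}^n\rho_\alpha(Y_i-X_i^{\mathsf T}\beta),\qquad \rho_\alpha(u)=\{\alpha-\mathbf 1(u<0)\}u .$$ Then, for every $t\ge 0$, as long as $n\ge C_2\, l_0^2\,\underline f^{-4}(p+t)$, with probability at least $1-e^{-t}$, $$\|\hat\beta-\beta^*\|_\Sigma\ \le\ C_1\,\underline f^{-1}\sqrt{\frac{p+t}{n}},\qquad\text{where } \|u\|_\Sigma=\|\Sigma^{1/2}u\|_2 .$$ -/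

import Mathlib

open MeasureTheory ProbabilityTheory

noncomputable section

namespace QuantileReg

/-- The check function `ρ_α(u) = {α - 1(u < 0)} u`. -/
def checkLoss (α u : ℝ) : ℝ := (α - if u < 0 then 1 else 0) * u

/-- The empirical quantile loss `b ↦ n⁻¹ ∑ ρ_α(y_i - x_iᵀ b)` of the data `(x_i, y_i)`, `i < n`. -/
def empiricalLoss {p n : ℕ} (α : ℝ) (x : Fin n → EuclideanSpace ℝ (Fin p)) (y : Fin n → ℝ)
    (b : EuclideanSpace ℝ (Fin p)) : ℝ :=
  (1 / (n : ℝ)) * ∑ i, checkLoss α (y i - inner ℝ (x i) b)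

/-- `b` is a quantile regression estimate: a global minimizer over `ℝᵖ` of the empirical loss. -/
def IsQREstimate {p n : ℕ} (α : ℝ) (x : Fin n → EuclideanSpace ℝ (Fin p)) (y : Fin n → ℝ)
    (b : EuclideanSpace ℝ (Fin p)) : Prop :=
  ∀ b' : EuclideanSpace ℝ (Fin p), empiricalLoss α x y b ≤ empiricalLoss α x y b'

/-- The `α`-quantile `inf {y : F(y) ≥ α}` of a probability law `ν` on `ℝ` with distribution
function `F`. -/
def quantile (ν : Measure ℝ) (α : ℝ) : ℝ := sInf {y : ℝ | α ≤ cdf ν y}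

/-- The second moment matrix `Σ = E(X Xᵀ)`. -/
def secondMoment {Ω : Type*} [MeasurableSpace Ω] {p : ℕ} (P : Measure Ω)
    (X : Ω → EuclideanSpace ℝ (Fin p)) : Matrix (Fin p) (Fin p) ℝ :=
  Matrix.of fun i j => ∫ ω, X ω i * X ω j ∂P

open scoped MatrixOrder in
/-- The positive semidefinite square root `S^{1/2}` of a positive semidefinite matrix `S`. -/
def sqrtMatrix {p : ℕ} (S : Matrix (Fin p) (Fin p) ℝ) : Matrix (Fin p) (Fin p) ℝ := CFC.sqrt S

/-- The norm `‖u‖_S = ‖S^{1/2} u‖₂` attached to a positive semidefinite matrix `S`. -/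
def matNorm {p : ℕ} (S : Matrix (Fin p) (Fin p) ℝ) (u : EuclideanSpace ℝ (Fin p)) : ℝ :=
  ‖Matrix.toEuclideanCLM (𝕜 := ℝ) (sqrtMatrix S) u‖

/-- The standardized vector `W = Σ^{-1/2} X`. -/
def standardized {Ω : Type*} [MeasurableSpace Ω] {p : ℕ} (P : Measure Ω)
    (X : Ω → EuclideanSpace ℝ (Fin p)) (ω : Ω) : EuclideanSpace ℝ (Fin p) :=
  Matrix.toEuclideanCLM (𝕜 := ℝ) (sqrtMatrix (secondMoment P X))⁻¹ (X ω)

/-- The covariate vector `X` is sub-Gaussian with parameter `υ`: `Σ = E(X Xᵀ)` exists and is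
positive definite, and `P(|uᵀ W| ≥ υ t) ≤ 2 exp(-t² / 2)` for all `t ≥ 0` and all unit vectors
`u`, where `W = Σ^{-1/2} X`. -/
structure SubGaussianCovariate {Ω : Type*} [MeasurableSpace Ω] {p : ℕ} (P : Measure Ω)
    (X : Ω → EuclideanSpace ℝ (Fin p)) (υ : ℝ) : Prop where
  memLp : MemLp X 2 P
  posDef : (secondMoment P X).PosDef
  tail : ∀ t : ℝ, 0 ≤ t → ∀ u : EuclideanSpace ℝ (Fin p), ‖u‖ = 1 →
    P.real {ω | υ * t ≤ |inner ℝ u (standardized P X ω)|} ≤ 2 * Real.exp (-t ^ 2 / 2)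

/-- The law `ν` on `ℝ` has a Lebesgue density `f` which is continuous on its support `{f ≠ 0}`,
with `f(0) ≥ fl` and `|f(s) - f(0)| ≤ l₀ |s|` for all real `s`. -/
def HasRegularDensity (ν : Measure ℝ) (fl l₀ : ℝ) : Prop :=
  ∃ f : ℝ → ℝ, Measurable f ∧ (∀ s, 0 ≤ f s) ∧
    ν = volume.withDensity (fun s => ENNReal.ofReal (f s)) ∧
    ContinuousOn f (Function.support f) ∧
    fl ≤ f 0 ∧ ∀ s, |f s - f 0| ≤ l₀ * |s|

/-- The linear conditional quantile model `Q_α(Y | X) = Xᵀ β`, almost surely;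
`condDistrib Y X P x` is the conditional law of `Y` given `X = x`. -/
def LinearQuantileModel {Ω : Type*} [MeasurableSpace Ω] {p : ℕ} (P : Measure Ω)
    [IsFiniteMeasure P] (X : Ω → EuclideanSpace ℝ (Fin p)) (Y : Ω → ℝ) (α : ℝ)
    (β : EuclideanSpace ℝ (Fin p)) : Prop :=
  ∀ᵐ x ∂(P.map X), quantile (condDistrib Y X P x) α = inner ℝ x β

/-- Almost surely over `X`, the conditional law of `ε = Y - Xᵀ β` given `X` has a density that
is continuous on its support, at least `fl` at `0`, and Lipschitz around `0` with constant `l₀`. -/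
def RegularConditionalDensity {Ω : Type*} [MeasurableSpace Ω] {p : ℕ} (P : Measure Ω)
    [IsFiniteMeasure P] (X : Ω → EuclideanSpace ℝ (Fin p)) (Y : Ω → ℝ)
    (β : EuclideanSpace ℝ (Fin p)) (fl l₀ : ℝ) : Prop :=
  ∀ᵐ x ∂(P.map X),
    HasRegularDensity (condDistrib (fun ω => Y ω - inner ℝ (X ω) β) X P x) fl l₀

end QuantileReg

end

namespace QuantileReg

/-! Write `δ = Σ^{1/2}(β - β*)`, so that the loss increment at `β` involves only `ε_i` and `⟨δ,
W_i⟩`. The empirical loss is convex. If the minimizer lies farther than `r` from `β*` in the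
`Σ`-norm, the point of the segment from `β*` to it at distance `r` already has a nonpositive loss
increment. It therefore suffices that all increments on the sphere `‖δ‖ = r` be positive, for `r` of
order `fl⁻¹ s` with `s = √((p+t)/n)`.

By Knight's identity an increment is minus a linear score term plus a nonnegative remainder. The
score has conditional mean zero because `P(ε < 0 | X) = α`, so the linear term is at most of order
`n s r` uniformly over the sphere. The remainder has mean at least of order `n fl r²`, since the
density of `ε` is bounded below near `0`. A large constant in `r` lets the remainder win.

The remainder must be bounded below uniformly in `δ`, while `f(0)` has no upper bound. Two devices
handle this. The remainder is truncated at level `h = K r`, which makes it bounded and supported on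
`|ε| ≤ h`. It is also multiplied by a weight `w(X) ∈ [0, 1]` (`thinning`) that caps the conditional
mass of `[-h, h]` at `fl h`. Nonnegativity of the remainder makes both operations harmless for a
lower bound, and its variance becomes comparable to `fl h³`.

Uniformity comes from a net of the sphere of fixed resolution, with exponentially many points in
`p`, and three Chernoff bounds at each point: for the score, for the Lipschitz modulus of the
remainder, and for the remainder itself. The deterministic part is `sum_checkLoss_sub_ge`, the
probabilistic part `measure_exists_sphere_nonpos_le`. The sample size condition gives `h ≤ fl/(2
l₀)`; with `fl² ≤ 4 l₀`, which holds because a density has mass one, it also bounds `s` by a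
constant. -/

/-! ### Nets of the unit sphere. -/

theorem card_le_of_separated_sphere {E : Type*} [NormedAddCommGroup E] [NormedSpace ℝ E]
    [FiniteDimensional ℝ E] {η : ℝ} (hη : 0 < η) (s : Finset E) (hs : ∀ c ∈ s, ‖c‖ = 1)
    (h : ∀ c ∈ s, ∀ d ∈ s, c ≠ d → η ≤ ‖c - d‖) :
    (s.card : ℝ) ≤ (1 + 2 / η) ^ Module.finrank ℝ E := by
  borelize E
  let μ : Measure E := Measure.addHaar
  have hρ : 0 < 1 + η / 2 := by positivity
  have D : Set.Pairwise (s : Set E) (Function.onFun Disjoint fun c => Metric.ball c (η / 2)) := by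
    rintro c hc d hd hcd
    apply Metric.ball_disjoint_ball
    rw [dist_eq_norm]
    linarith [h c hc d hd hcd]
  -- Volume comparison: the disjoint balls of radius `η / 2` all fit in the ball of radius `1 + η /
  -- 2`.
  have hsub : (⋃ c ∈ s, Metric.ball c (η / 2)) ⊆ Metric.ball (0 : E) (1 + η / 2) := by
    refine Set.iUnion₂_subset fun x hx => Metric.ball_subset_ball' ?_
    rw [dist_zero_right, hs x hx, add_comm]
  have I : (s.card : ENNReal) * ENNReal.ofReal ((η / 2) ^ Module.finrank ℝ E) * μ (Metric.ball 0 1)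
      ≤ ENNReal.ofReal ((1 + η / 2) ^ Module.finrank ℝ E) * μ (Metric.ball 0 1) := by
    calc _ = μ (⋃ c ∈ s, Metric.ball c (η / 2)) := by
          rw [measure_biUnion_finset D fun c _ => measurableSet_ball]
          simp only [μ.addHaar_ball_of_pos _ (half_pos hη), Finset.sum_const, nsmul_eq_mul, mul_assoc]
      _ ≤ μ (Metric.ball (0 : E) (1 + η / 2)) := measure_mono hsub
      _ = _ := by simp only [μ.addHaar_ball_of_pos _ hρ]
  have J := (ENNReal.mul_le_mul_iff_left (Metric.measure_ball_pos μ 0 zero_lt_one).ne'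
    measure_ball_lt_top.ne).1 I
  have K := ENNReal.toReal_le_of_le_ofReal (pow_nonneg hρ.le _) J
  rw [ENNReal.toReal_mul, ENNReal.toReal_natCast, ENNReal.toReal_ofReal (by positivity)] at K
  have h1 : 1 + 2 / η = (1 + η / 2) / (η / 2) := by field_simp; ring
  rw [h1, div_pow, le_div_iff₀ (by positivity)]
  exact K

/-- The unit sphere of a finite-dimensional space has an `η`-net of cardinality at most
`(1 + 2 / η) ^ dim`. -/
theorem exists_net_sphere (E : Type*) [NormedAddCommGroup E] [NormedSpace ℝ E]
    [FiniteDimensional ℝ E] {η : ℝ} (hη : 0 < η) :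
    ∃ s : Finset E, (∀ c ∈ s, ‖c‖ = 1) ∧ (∀ u : E, ‖u‖ = 1 → ∃ c ∈ s, ‖u - c‖ ≤ η) ∧
      (s.card : ℝ) ≤ (1 + 2 / η) ^ Module.finrank ℝ E := by
  classical
  let Q : ℕ → Prop := fun k => ∃ s : Finset E, s.card = k ∧ (∀ c ∈ s, ‖c‖ = 1) ∧
    ∀ c ∈ s, ∀ d ∈ s, c ≠ d → η ≤ ‖c - d‖
  have hQ0 : Q 0 := ⟨∅, by simp⟩
  let N := ⌈(1 + 2 / η) ^ Module.finrank ℝ E⌉₊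
  have hQ : ∀ k, Q k → k ≤ N := by
    rintro k ⟨s, rfl, hs, h⟩
    exact_mod_cast (card_le_of_separated_sphere hη s hs h).trans (Nat.le_ceil _)
  obtain ⟨s, hsc, hs, hsep⟩ : Q (Nat.findGreatest Q N) := Nat.findGreatest_spec (Nat.zero_le N) hQ0
  refine ⟨s, hs, fun u hu => ?_, card_le_of_separated_sphere hη s hs hsep⟩
  by_contra! hc
  have hus : u ∉ s := fun hus => by have := hc u hus; simp at this; linarith
  -- A separated set of maximal cardinality is a net: a point far from all of `s` could be added to
  -- it.
  have hins : Q (s.card + 1) := by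
    refine ⟨insert u s, Finset.card_insert_of_notMem hus, ?_, ?_⟩
    · intro c hcs
      rcases Finset.mem_insert.1 hcs with rfl | hcs
      exacts [hu, hs c hcs]
    · intro c hcs d hds hcd
      rcases Finset.mem_insert.1 hcs with hcu | hcs <;>
        rcases Finset.mem_insert.1 hds with hdu | hds
      · exact absurd (hcu.trans hdu.symm) hcd
      · rw [hcu]; exact (hc d hds).le
      · rw [hdu, norm_sub_rev]; exact (hc c hcs).le
      · exact hsep c hcs d hds hcd
  have := Nat.le_findGreatest (hQ _ hins) hins
  omega

/-! ### Knight's identity and the truncated remainder. -/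

/-- The subgradient factor `α - 1(e < 0)` of the check loss. -/
noncomputable def score (α e : ℝ) : ℝ := α - if e < 0 then 1 else 0

/-- The remainder in Knight's identity, with the increment `v` truncated at level `h`. -/
noncomputable def hinge (h e v : ℝ) : ℝ :=
  if 0 ≤ e then max 0 (min v h - e) else max 0 (min (-v) h + e)

/-- Without truncation this is Knight's identity, with equality; replacing `v` or `-v` by its
minimum with `h` only lowers the remainder. -/
theorem checkLoss_sub_ge (α h e v : ℝ) :
    -(score α e * v) + hinge h e v ≤ checkLoss α (e - v) - checkLoss α e := by
  unfold checkLoss score hinge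
  have h1 := min_le_left v h
  have h2 := min_le_left (-v) h
  by_cases he : 0 ≤ e
  · rw [if_neg he.not_gt, if_pos he]
    split_ifs
    · have : max 0 (min v h - e) ≤ v - e := max_le (by linarith) (by linarith)
      linarith
    · have : max 0 (min v h - e) = 0 := max_eq_left (by linarith)
      linarith
  · rw [if_pos (not_le.1 he), if_neg he]
    split_ifs with hv
    · have : max 0 (min (-v) h + e) = 0 := max_eq_left (by linarith)
      linarith
    · have : max 0 (min (-v) h + e) ≤ -v + e := max_le (by linarith) (by linarith)
      linarith

theorem hinge_nonneg (h e v : ℝ) : 0 ≤ hinge h e v := by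
  unfold hinge; split_ifs <;> exact le_max_left _ _

theorem hinge_le {h : ℝ} (hh : 0 ≤ h) (e v : ℝ) :
    hinge h e v ≤ (Set.Icc (-h) h).indicator (fun _ => h) e := by
  unfold hinge
  have h1 := min_le_right v h
  have h2 := min_le_right (-v) h
  by_cases hm : e ∈ Set.Icc (-h) h
  · rw [Set.indicator_of_mem hm]
    split_ifs with he
    · exact max_le hh (by linarith)
    · exact max_le hh (by linarith)
  · rw [Set.indicator_of_notMem hm]
    simp only [Set.mem_Icc, not_and_or, not_le] at hm
    split_ifs with he
    · exact max_le le_rfl (by rcases hm with hm | hm <;> linarith)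
    · exact max_le le_rfl (by rcases hm with hm | hm <;> linarith)

theorem abs_max_zero_sub_le (a b : ℝ) : |max 0 a - max 0 b| ≤ |a - b| := by
  have := abs_max_sub_max_le_max 0 a 0 b
  simpa using this

theorem abs_min_sub_le (a b h : ℝ) : |min a h - min b h| ≤ |a - b| := by
  have := abs_min_sub_min_le_max a h b h
  simpa using this

/-- The remainder vanishes for `|e| > h`, so moving `v` costs something only on the event `|e| ≤ h`.
This small event keeps the discretization error proportional to `fl h`. -/
theorem hinge_lipschitz {h : ℝ} (hh : 0 ≤ h) (e v v' : ℝ) :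
    hinge h e v - hinge h e v' ≤ (Set.Icc (-h) h).indicator (fun _ => |v - v'|) e := by
  by_cases hm : e ∈ Set.Icc (-h) h
  · rw [Set.indicator_of_mem hm]
    refine (le_abs_self _).trans ?_
    unfold hinge
    split_ifs with he
    · refine (abs_max_zero_sub_le _ _).trans ?_
      simpa using abs_min_sub_le v v' h
    · refine (abs_max_zero_sub_le _ _).trans ?_
      have := abs_min_sub_le (-v) (-v') h
      rw [show -v - -v' = -(v - v') by ring, abs_neg] at this
      simpa using this
  · have h1 := hinge_le hh e v
    rw [Set.indicator_of_notMem hm] at h1 ⊢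
    linarith [hinge_nonneg h e v']

theorem le_hinge_of_pos {h e v : ℝ} (he : e ∈ Set.Icc 0 (min v h / 2)) :
    min v h / 2 ≤ hinge h e v := by
  unfold hinge
  rw [if_pos he.1]
  exact le_max_of_le_right (by linarith [he.2])

theorem le_hinge_of_neg {h e v : ℝ} (he : e ∈ Set.Ico (-(min (-v) h / 2)) 0) :
    min (-v) h / 2 ≤ hinge h e v := by
  unfold hinge
  rw [if_neg (not_le.2 he.2)]
  exact le_max_of_le_right (by linarith [he.1])

theorem checkLoss_eq_max (α u : ℝ) : checkLoss α u = max (α * u) ((α - 1) * u) := by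
  unfold checkLoss
  split_ifs with h
  · rw [max_eq_right]; nlinarith
  · rw [max_eq_left]
    · ring
    · push Not at h; nlinarith

theorem convexOn_checkLoss (α : ℝ) : ConvexOn ℝ Set.univ (checkLoss α) := by
  have : checkLoss α = (fun u => α * u) ⊔ (fun u => (α - 1) * u) := by
    ext u; exact checkLoss_eq_max α u
  rw [this]
  exact ((LinearMap.mul ℝ ℝ α).convexOn convex_univ).sup
    ((LinearMap.mul ℝ ℝ (α - 1)).convexOn convex_univ)

/-! ### Deterministic control of the loss on a sphere. -/

/-- A sublinear function bounded by `M` on a `1/2`-net of the sphere is bounded by `2 M` on the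
sphere. -/
theorem le_two_mul_of_net {E : Type*} [NormedAddCommGroup E] [NormedSpace ℝ E]
    [FiniteDimensional ℝ E] {N : E → ℝ} (hN : Continuous N) (hadd : ∀ a b, N (a + b) ≤ N a + N b)
    (hsmul : ∀ (c : ℝ) a, 0 ≤ c → N (c • a) = c * N a) {s : Finset E}
    (hs : ∀ u : E, ‖u‖ = 1 → ∃ c ∈ s, ‖u - c‖ ≤ 1 / 2) {M : ℝ} (hM : ∀ c ∈ s, N c ≤ M)
    (u : E) : N u ≤ 2 * M * ‖u‖ := by
  have hN0 : N 0 = 0 := by simpa using hsmul 0 0 le_rfl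
  have : ProperSpace E := FiniteDimensional.proper ℝ E
  by_cases hu : u = 0
  · simp [hu, hN0]
  have hunit : ∀ x : E, x ≠ 0 → ‖x‖⁻¹ • x ∈ Metric.sphere (0 : E) 1 := fun x hx => by
    rw [mem_sphere_zero_iff_norm]; exact norm_smul_inv_norm (𝕜 := ℝ) hx
  obtain ⟨m, hm, hmax⟩ := (isCompact_sphere (0 : E) 1).exists_isMaxOn ⟨_, hunit u hu⟩ hN.continuousOn
  rw [mem_sphere_zero_iff_norm] at hm
  have hle : ∀ x, N x ≤ ‖x‖ * N m := fun x => by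
    by_cases hx : x = 0
    · simp [hx, hN0]
    · have h1 : N (‖x‖⁻¹ • x) ≤ N m := hmax (hunit x hx)
      have hx' : 0 < ‖x‖ := norm_pos_iff.2 hx
      rw [hsmul _ _ (by positivity), inv_mul_le_iff₀ hx'] at h1
      exact h1
  -- The maximum is nonnegative because `0 = N (m + (-m)) ≤ N m + N (-m) ≤ 2 N m`.
  have hm0 : 0 ≤ N m := by
    have h1 := hadd m (-m)
    have h2 := hle (-m)
    rw [add_neg_cancel, hN0] at h1
    rw [norm_neg, hm] at h2
    linarith
  -- For `c` in the net near the maximizer `m`, `N m ≤ N c + N (m - c) ≤ M + N m / 2`.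
  obtain ⟨c, hc, hmc⟩ := hs m hm
  have h1 := hadd c (m - c)
  rw [add_sub_cancel] at h1
  have h2 := (hle (m - c)).trans (mul_le_mul_of_nonneg_right hmc hm0)
  have h3 := hM c hc
  rw [mul_comm]
  exact (hle u).trans (mul_le_mul_of_nonneg_left (by linarith) (norm_nonneg u))

/-- The score term and the Lipschitz modulus are both sublinear in the direction, so bounds on the
net extend to all directions at the price of a factor `2`. The remainder is not sublinear: it is
compared with its value at the nearest net point, and the modulus pays `2 M` times the distance `r
η`. -/
theorem sum_checkLoss_sub_ge {p n : ℕ} {G : Fin n → EuclideanSpace ℝ (Fin p)} {e w : Fin n → ℝ}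
    {α h r η L M Q : ℝ} {s : Finset (EuclideanSpace ℝ (Fin p))} (hh : 0 ≤ h) (hr : 0 < r)
    (hw0 : ∀ i, 0 ≤ w i) (hw1 : ∀ i, w i ≤ 1) (hη : η ≤ 1 / 2) (hM : 0 ≤ M)
    (hs : ∀ u : EuclideanSpace ℝ (Fin p), ‖u‖ = 1 → ∃ c ∈ s, ‖u - c‖ ≤ η)
    (h1 : ∀ c ∈ s, ∑ i, score α (e i) * inner ℝ c (G i) ≤ L)
    (h2 : ∀ c ∈ s, ∑ i, w i * (Set.Icc (-h) h).indicator (fun _ => |inner ℝ c (G i)|) (e i) ≤ M)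
    (h3 : ∀ c ∈ s, Q ≤ ∑ i, w i * hinge h (e i) (inner ℝ (r • c) (G i)))
    {δ : EuclideanSpace ℝ (Fin p)} (hδ : ‖δ‖ = r) :
    Q - 2 * M * (r * η) - 2 * L * r
      ≤ ∑ i, (checkLoss α (e i - inner ℝ δ (G i)) - checkLoss α (e i)) := by
  have hs' : ∀ u : EuclideanSpace ℝ (Fin p), ‖u‖ = 1 → ∃ c ∈ s, ‖u - c‖ ≤ 1 / 2 := fun u hu =>
    let ⟨c, hc, h⟩ := hs u hu; ⟨c, hc, h.trans hη⟩
  have k1 := le_two_mul_of_net (N := fun u => ∑ i, score α (e i) * inner ℝ u (G i))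
    (by fun_prop) (fun a b => by simp [inner_add_left, mul_add, Finset.sum_add_distrib])
    (fun c a _ => by simp only [real_inner_smul_left, Finset.mul_sum]; congr! 1; ring) hs' h1 δ
  have k2 := le_two_mul_of_net
    (N := fun u => ∑ i, w i * (Set.Icc (-h) h).indicator (fun _ => |inner ℝ u (G i)|) (e i))
    (by
      refine continuous_finsetSum _ fun i _ => continuous_const.mul ?_
      by_cases hi : e i ∈ Set.Icc (-h) h
      · simp only [Set.indicator_of_mem hi]; fun_prop
      · simp only [Set.indicator_of_notMem hi]; fun_prop)
    (fun a b => by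
      rw [← Finset.sum_add_distrib]
      refine Finset.sum_le_sum fun i _ => ?_
      rw [← mul_add]
      refine mul_le_mul_of_nonneg_left ?_ (hw0 i)
      by_cases hi : e i ∈ Set.Icc (-h) h
      · simp only [Set.indicator_of_mem hi, inner_add_left]; exact abs_add_le _ _
      · simp only [Set.indicator_of_notMem hi]; simp)
    (fun c a hc => by
      rw [Finset.mul_sum]
      refine Finset.sum_congr rfl fun i _ => ?_
      by_cases hi : e i ∈ Set.Icc (-h) h
      · simp only [Set.indicator_of_mem hi, real_inner_smul_left, abs_mul, abs_of_nonneg hc]; ring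
      · simp only [Set.indicator_of_notMem hi]; simp) hs' h2
  obtain ⟨c, hc, hcu⟩ := hs (r⁻¹ • δ) (by
    rw [norm_smul, hδ, norm_inv, Real.norm_of_nonneg hr.le, inv_mul_cancel₀ hr.ne'])
  have hdc : ‖r • c - δ‖ ≤ r * η := by
    have : r • c - δ = -(r • (r⁻¹ • δ - c)) := by
      rw [smul_sub, smul_inv_smul₀ hr.ne', neg_sub]
    rw [this, norm_neg, norm_smul, Real.norm_of_nonneg hr.le]
    exact mul_le_mul_of_nonneg_left hcu hr.le
  have k3 : ∑ i, w i * hinge h (e i) (inner ℝ (r • c) (G i))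
      - ∑ i, w i * hinge h (e i) (inner ℝ δ (G i)) ≤ 2 * M * (r * η) := by
    refine le_trans ?_ ((k2 (r • c - δ)).trans (mul_le_mul_of_nonneg_left hdc (by positivity)))
    rw [← Finset.sum_sub_distrib]
    refine Finset.sum_le_sum fun i _ => ?_
    rw [← mul_sub, inner_sub_left]
    exact mul_le_mul_of_nonneg_left (hinge_lipschitz hh _ _ _) (hw0 i)
  have k4 : ∑ i, w i * hinge h (e i) (inner ℝ δ (G i)) - ∑ i, score α (e i) * inner ℝ δ (G i)
      ≤ ∑ i, (checkLoss α (e i - inner ℝ δ (G i)) - checkLoss α (e i)) := by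
    rw [← Finset.sum_sub_distrib]
    refine Finset.sum_le_sum fun i _ => ?_
    have a1 := checkLoss_sub_ge α h (e i) (inner ℝ δ (G i))
    have a2 := mul_le_mul_of_nonneg_right (hw1 i) (hinge_nonneg h (e i) (inner ℝ δ (G i)))
    linarith
  have k5 := h3 c hc
  rw [hδ] at k1
  linarith

/-- By convexity, the increment at a point of the segment is at most `θ` times the increment at the
minimizer, which is nonpositive. -/
theorem sum_checkLoss_segment_nonpos {p n : ℕ} {α : ℝ} (x : Fin n → EuclideanSpace ℝ (Fin p))
    (y : Fin n → ℝ) (b b' : EuclideanSpace ℝ (Fin p)) {θ : ℝ} (hθ0 : 0 ≤ θ) (hθ1 : θ ≤ 1)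
    (hn : 0 < n) (hb : IsQREstimate α x y b') :
    ∑ i, (checkLoss α (y i - inner ℝ (x i) b - inner ℝ (x i) (θ • (b' - b)))
      - checkLoss α (y i - inner ℝ (x i) b)) ≤ 0 := by
  have h1 := hb b
  unfold empiricalLoss at h1
  have hn' : (0 : ℝ) < 1 / n := by positivity
  have h2 := le_of_mul_le_mul_left h1 hn'
  have h3 : ∀ i, checkLoss α (y i - inner ℝ (x i) b - inner ℝ (x i) (θ • (b' - b)))
      ≤ (1 - θ) * checkLoss α (y i - inner ℝ (x i) b) + θ * checkLoss α (y i - inner ℝ (x i) b') := by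
    intro i
    have := (convexOn_checkLoss α).2 (Set.mem_univ (y i - inner ℝ (x i) b))
      (Set.mem_univ (y i - inner ℝ (x i) b')) (sub_nonneg.2 hθ1) hθ0 (by ring)
    refine le_trans (le_of_eq ?_) this
    congr 1
    simp only [inner_smul_right, inner_sub_right, smul_eq_mul]
    ring
  calc _ ≤ ∑ i, θ * (checkLoss α (y i - inner ℝ (x i) b') - checkLoss α (y i - inner ℝ (x i) b)) := by
        refine Finset.sum_le_sum fun i _ => ?_
        linarith [h3 i]
    _ ≤ 0 := by
        rw [← Finset.mul_sum, Finset.sum_sub_distrib]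
        exact mul_nonpos_of_nonneg_of_nonpos hθ0 (by linarith)

/-! ### Exponential moments and Chernoff bounds. -/

/-- A bound for the exponential moment of a variable with Gaussian tails. -/
noncomputable def expConst : ℝ := ∑' k : ℕ, 2 * Real.exp (k + 1 - (k : ℝ) ^ 2 / 2)

theorem summable_expConst : Summable fun k : ℕ => 2 * Real.exp (k + 1 - (k : ℝ) ^ 2 / 2) := by
  refine Summable.mul_left 2 ?_
  refine Summable.of_nonneg_of_le (fun _ => (Real.exp_pos _).le) (fun k => ?_)
    (Real.summable_exp_neg_nat.mul_left (Real.exp 3))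
  rw [← Real.exp_add]
  exact Real.exp_le_exp.2 (by nlinarith [sq_nonneg ((k : ℝ) - 2)])

theorem one_le_expConst : 1 ≤ expConst := by
  have h := summable_expConst.le_tsum 0 (fun k _ => by positivity)
  have h1 := Real.add_one_le_exp (1 : ℝ)
  norm_num at h
  unfold expConst
  linarith

theorem ofReal_exp_le_tsum {x : ℝ} (hx : 0 ≤ x) :
    ENNReal.ofReal (Real.exp x)
      ≤ ∑' k : ℕ, (Set.Ici (k : ℝ)).indicator (fun _ => ENNReal.ofReal (Real.exp (k + 1))) x := by
  refine le_trans ?_ (ENNReal.le_tsum ⌊x⌋₊)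
  rw [Set.indicator_of_mem (Set.mem_Ici.2 (Nat.floor_le hx))]
  exact ENNReal.ofReal_le_ofReal (Real.exp_le_exp.2 (Nat.lt_floor_add_one x).le)

/-- Peeling: on `k ≤ |g|/υ < k + 1` the exponential is at most `e^(k+1)`, and the tail bound makes
the sum over `k` converge. -/
theorem lintegral_exp_le {𝒳 : Type*} [MeasurableSpace 𝒳] {m : Measure 𝒳} [IsFiniteMeasure m]
    {g : 𝒳 → ℝ} (hg : Measurable g) {υ : ℝ} (hυ : 0 < υ)
    (htail : ∀ s : ℝ, 0 ≤ s → m.real {x | υ * s ≤ |g x|} ≤ 2 * Real.exp (-s ^ 2 / 2)) :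
    ∫⁻ x, ENNReal.ofReal (Real.exp (|g x| / υ)) ∂m ≤ ENNReal.ofReal expConst := by
  have hms : ∀ k : ℕ, MeasurableSet {x | υ * k ≤ |g x|} := fun k =>
    measurableSet_le measurable_const hg.abs
  calc _ ≤ ∫⁻ x, ∑' k : ℕ, {x | υ * k ≤ |g x|}.indicator
          (fun _ => ENNReal.ofReal (Real.exp (k + 1))) x ∂m := by
        refine lintegral_mono fun x => (ofReal_exp_le_tsum (by positivity)).trans (le_of_eq ?_)
        congr! 2 with k
        simp only [Set.indicator_apply, Set.mem_Ici, Set.mem_ofPred_eq, le_div_iff₀ hυ, mul_comm]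
    _ = ∑' k : ℕ, ENNReal.ofReal (Real.exp (k + 1)) * m {x | υ * k ≤ |g x|} := by
        rw [lintegral_tsum fun k => (measurable_const.indicator (hms k)).aemeasurable]
        congr! 2 with k
        rw [lintegral_indicator_const (hms k)]
    _ ≤ ∑' k : ℕ, ENNReal.ofReal (2 * Real.exp (k + 1 - (k : ℝ) ^ 2 / 2)) := by
        refine ENNReal.tsum_le_tsum fun k => ?_
        rw [← ofReal_measureReal, ← ENNReal.ofReal_mul (Real.exp_pos _).le]
        refine ENNReal.ofReal_le_ofReal ?_
        refine (mul_le_mul_of_nonneg_left (htail k k.cast_nonneg) (Real.exp_pos _).le).trans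
          (le_of_eq ?_)
        rw [sub_eq_add_neg, Real.exp_add ((k : ℝ) + 1), neg_div]
        ring
    _ = ENNReal.ofReal expConst :=
        (ENNReal.ofReal_tsum_of_nonneg (fun k => by positivity) summable_expConst).symm

theorem integrable_exp_of_tail {𝒳 : Type*} [MeasurableSpace 𝒳] {m : Measure 𝒳} [IsFiniteMeasure m]
    {g : 𝒳 → ℝ} (hg : Measurable g) {υ : ℝ} (hυ : 0 < υ)
    (htail : ∀ s : ℝ, 0 ≤ s → m.real {x | υ * s ≤ |g x|} ≤ 2 * Real.exp (-s ^ 2 / 2)) :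
    Integrable (fun x => Real.exp (|g x| / υ)) m :=
  (lintegral_ofReal_ne_top_iff_integrable (by fun_prop) (ae_of_all _ fun _ => by positivity)).1
    ((lintegral_exp_le hg hυ htail).trans_lt ENNReal.ofReal_lt_top).ne

theorem integral_exp_le {𝒳 : Type*} [MeasurableSpace 𝒳] {m : Measure 𝒳} [IsFiniteMeasure m]
    {g : 𝒳 → ℝ} (hg : Measurable g) {υ : ℝ} (hυ : 0 < υ)
    (htail : ∀ s : ℝ, 0 ≤ s → m.real {x | υ * s ≤ |g x|} ≤ 2 * Real.exp (-s ^ 2 / 2)) :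
    ∫ x, Real.exp (|g x| / υ) ∂m ≤ expConst := by
  rw [← ENNReal.ofReal_le_ofReal_iff (zero_le_one.trans one_le_expConst),
    ofReal_integral_eq_lintegral_ofReal (integrable_exp_of_tail hg hυ htail)
      (ae_of_all _ fun _ => by positivity)]
  exact lintegral_exp_le hg hυ htail

theorem pow_le_factorial_mul_exp {x : ℝ} (hx : 0 ≤ x) (k : ℕ) :
    x ^ k ≤ k.factorial * Real.exp x := by
  have := Real.pow_div_factorial_le_exp x hx k
  rwa [div_le_iff₀ (by positivity), mul_comm] at this

/-- The truncated second moment of a standardized variable with Gaussian tails. -/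
theorem half_le_integral_min_sq {𝒳 : Type*} [MeasurableSpace 𝒳] {m : Measure 𝒳}
    [IsFiniteMeasure m] {g : 𝒳 → ℝ} (hg : Measurable g) {υ : ℝ} (hυ : 0 < υ)
    (htail : ∀ s : ℝ, 0 ≤ s → m.real {x | υ * s ≤ |g x|} ≤ 2 * Real.exp (-s ^ 2 / 2))
    (hvar : ∫ x, g x ^ 2 ∂m = 1) :
    1 / 2 ≤ ∫ x, (min |g x| (12 * υ ^ 3 * expConst)) ^ 2 ∂m := by
  set K := 12 * υ ^ 3 * expConst with hK
  have hC := one_le_expConst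
  have hK0 : 0 < K := by positivity
  have hint := integrable_exp_of_tail hg hυ htail
  have hpt : ∀ x, g x ^ 2 - 6 * υ ^ 3 / K * Real.exp (|g x| / υ) ≤ (min |g x| K) ^ 2 := by
    intro x
    rcases le_total |g x| K with h | h
    · rw [min_eq_left h, sq_abs]
      have : 0 ≤ 6 * υ ^ 3 / K * Real.exp (|g x| / υ) := by positivity
      linarith
    · rw [min_eq_right h]
      have h3 := pow_le_factorial_mul_exp (x := |g x| / υ) (by positivity) 3
      rw [div_pow, div_le_iff₀ (by positivity)] at h3
      have h4 : K * g x ^ 2 ≤ |g x| ^ 3 := by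
        rw [show |g x| ^ 3 = |g x| * g x ^ 2 by rw [← sq_abs (g x)]; ring]
        exact mul_le_mul_of_nonneg_right h (sq_nonneg _)
      have h5 : g x ^ 2 ≤ 6 * υ ^ 3 / K * Real.exp (|g x| / υ) := by
        rw [div_mul_eq_mul_div, le_div_iff₀ hK0]
        norm_num [Nat.factorial] at h3
        linarith
      nlinarith [sq_nonneg K]
  -- A non-integrable function would have Bochner integral `0`, contradicting `hvar`.
  have hsq : Integrable (fun x => g x ^ 2) m := by
    by_contra hcon
    rw [integral_undef hcon] at hvar
    norm_num at hvar
  have h1 := integral_mono (hsq.sub (hint.const_mul (6 * υ ^ 3 / K)))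
    (g := fun x => (min |g x| K) ^ 2)
    (hsq.mono' (by fun_prop) (ae_of_all _ fun x => by
      rw [Real.norm_of_nonneg (sq_nonneg _), ← sq_abs (g x)]
      exact pow_le_pow_left₀ (le_min (abs_nonneg _) hK0.le) (min_le_left _ _) 2)) hpt
  simp only [Pi.sub_apply] at h1
  rw [integral_sub hsq (hint.const_mul _), hvar, integral_const_mul] at h1
  have h2 : 6 * υ ^ 3 / K * ∫ x, Real.exp (|g x| / υ) ∂m ≤ 1 / 2 := by
    have : 6 * υ ^ 3 / K * expConst = 1 / 2 := by rw [hK]; field_simp; norm_num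
    rw [← this]
    exact mul_le_mul_of_nonneg_left (integral_exp_le hg hυ htail) (by positivity)
  linarith

/-- Chernoff bound for sums over an i.i.d. sample. -/
theorem measure_sum_ge_le {Ω 𝒵 : Type*} [MeasurableSpace Ω] [MeasurableSpace 𝒵] {P : Measure Ω}
    {μ : Measure 𝒵} {n : ℕ} {ξ : Fin n → Ω → 𝒵} (hξ : iIndepFun ξ P)
    (hm : ∀ i, AEMeasurable (ξ i) P) (hlaw : ∀ i, P.map (ξ i) = μ) {F : 𝒵 → ℝ} (hF : Measurable F)
    {c : ℝ} (hc : ∫⁻ z, ENNReal.ofReal (Real.exp (F z)) ∂μ ≤ ENNReal.ofReal (Real.exp c)) (T : ℝ) :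
    P {ω | T ≤ ∑ i, F (ξ i ω)} ≤ ENNReal.ofReal (Real.exp (n * c - T)) := by
  have hFm : Measurable fun z => ENNReal.ofReal (Real.exp (F z)) := by fun_prop
  -- Independence survives passing to measurable versions, which the product formula for lower
  -- integrals needs.
  have hmk : iIndepFun (fun i => (hm i).mk (ξ i)) P := hξ.congr fun i => (hm i).ae_eq_mk
  have hprod : ∫⁻ ω, ∏ i, ENNReal.ofReal (Real.exp (F (ξ i ω))) ∂P
      ≤ ENNReal.ofReal (Real.exp (n * c)) := by
    calc _ = ∫⁻ ω, ∏ i, ENNReal.ofReal (Real.exp (F ((hm i).mk (ξ i) ω))) ∂P := by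
          refine lintegral_congr_ae ?_
          filter_upwards [ae_all_iff.2 fun i => (hm i).ae_eq_mk] with ω hω
          simp only [hω]
      _ = ∏ i, ∫⁻ ω, ENNReal.ofReal (Real.exp (F ((hm i).mk (ξ i) ω))) ∂P :=
          lintegral_prod_eq_prod_lintegral_of_indepFun Finset.univ
            (fun i ω => ENNReal.ofReal (Real.exp (F ((hm i).mk (ξ i) ω))))
            (hmk.comp (fun _ z => ENNReal.ofReal (Real.exp (F z))) fun _ => hFm)
            fun i => hFm.comp (hm i).measurable_mk
      _ ≤ ∏ _i : Fin n, ENNReal.ofReal (Real.exp c) := by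
          refine Finset.prod_le_prod' fun i _ => le_trans (le_of_eq ?_) hc
          rw [← hlaw i, Measure.map_congr (hm i).ae_eq_mk, lintegral_map hFm (hm i).measurable_mk]
      _ = ENNReal.ofReal (Real.exp (n * c)) := by
          rw [Finset.prod_const, Finset.card_univ, Fintype.card_fin,
            ← ENNReal.ofReal_pow (Real.exp_pos _).le, ← Real.exp_nat_mul]
  have hsum : ∀ ω, ∏ i, ENNReal.ofReal (Real.exp (F (ξ i ω)))
      = ENNReal.ofReal (Real.exp (∑ i, F (ξ i ω))) := fun ω => by
    rw [Real.exp_sum, ENNReal.ofReal_prod_of_nonneg fun _ _ => (Real.exp_pos _).le]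
  simp only [hsum] at hprod
  have hmark := meas_ge_le_lintegral_div (μ := P)
    (f := fun ω => ENNReal.ofReal (Real.exp (∑ i, F (ξ i ω))))
    (by
      have : ∀ i, AEMeasurable (fun ω => F (ξ i ω)) P := fun i => hF.comp_aemeasurable (hm i)
      fun_prop) (ε := ENNReal.ofReal (Real.exp T))
    (by simp [Real.exp_pos]) ENNReal.ofReal_ne_top
  calc _ = P {ω | ENNReal.ofReal (Real.exp T) ≤ ENNReal.ofReal (Real.exp (∑ i, F (ξ i ω)))} := by
        congr! 3 with ω
        rw [ENNReal.ofReal_le_ofReal_iff (Real.exp_pos _).le, Real.exp_le_exp]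
    _ ≤ _ := hmark
    _ ≤ ENNReal.ofReal (Real.exp (n * c)) / ENNReal.ofReal (Real.exp T) := by gcongr
    _ = _ := by rw [← ENNReal.ofReal_div_of_pos (Real.exp_pos _), Real.exp_sub]

theorem exp_le_one_add_add_sq (x : ℝ) : Real.exp x ≤ 1 + x + x ^ 2 * Real.exp |x| := by
  have h := Complex.norm_exp_sub_sum_le_norm_mul_exp (x : ℂ) 2
  simp only [Finset.sum_range_succ, Finset.sum_range_zero] at h
  norm_num at h
  have h2 : Complex.exp x - (1 + x) = ((Real.exp x - (1 + x) : ℝ) : ℂ) := by push_cast; ring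
  rw [h2, Complex.norm_real] at h
  have := (Real.le_norm_self _).trans h
  linarith

theorem exp_neg_le_one_sub_add_sq {x : ℝ} (hx : 0 ≤ x) : Real.exp (-x) ≤ 1 - x + x ^ 2 := by
  rw [Real.exp_neg]
  have h := Real.add_one_le_exp x
  refine (inv_anti₀ (by linarith) h).trans ?_
  rw [inv_le_iff_one_le_mul₀ (by linarith)]
  nlinarith [pow_nonneg hx 3]

theorem exp_mul_le_one_add_mul_exp {w y : ℝ} (hw0 : 0 ≤ w) (hw1 : w ≤ 1) :
    Real.exp (w * y) ≤ 1 + w * Real.exp y := by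
  have := convexOn_exp.2 (Set.mem_univ 0) (Set.mem_univ y) (sub_nonneg.2 hw1) hw0 (by ring)
  simp only [smul_eq_mul, mul_zero, zero_add, Real.exp_zero, mul_one] at this
  linarith

/-- To bound the integral of `exp F` against `m ⊗ κ` it suffices to bound the inner integrals. -/
theorem lintegral_compProd_exp_le {𝒳 : Type*} [MeasurableSpace 𝒳] {m : Measure 𝒳} [SFinite m]
    {κ : Kernel 𝒳 ℝ} [IsSFiniteKernel κ] {F : 𝒳 × ℝ → ℝ} (hF : Measurable F) {B : 𝒳 → ℝ}
    (hB : Integrable B m) (hB0 : ∀ᵐ x ∂m, 0 ≤ B x)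
    (h : ∀ᵐ x ∂m, ∫⁻ e, ENNReal.ofReal (Real.exp (F (x, e))) ∂κ x ≤ ENNReal.ofReal (B x)) :
    ∫⁻ z, ENNReal.ofReal (Real.exp (F z)) ∂(m ⊗ₘ κ) ≤ ENNReal.ofReal (∫ x, B x ∂m) := by
  rw [Measure.lintegral_compProd (by fun_prop), ofReal_integral_eq_lintegral_ofReal hB hB0]
  exact lintegral_mono_ae h

/-- Bound of a lower integral by a Bochner integral of a dominating function. -/
theorem lintegral_ofReal_exp_le {ν : Measure ℝ} {F H : ℝ → ℝ} (hH : Integrable H ν)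
    (h : ∀ e, Real.exp (F e) ≤ H e) {b : ℝ} (hb : ∫ e, H e ∂ν ≤ b) :
    ∫⁻ e, ENNReal.ofReal (Real.exp (F e)) ∂ν ≤ ENNReal.ofReal b := by
  refine (lintegral_mono fun e => ENNReal.ofReal_le_ofReal (h e)).trans ?_
  rw [← ofReal_integral_eq_lintegral_ofReal hH
    (ae_of_all _ fun e => (Real.exp_pos _).le.trans (h e))]
  exact ENNReal.ofReal_le_ofReal hb

/-! ### Thinning and conditional exponential moments. -/

/-- The thinning weight of a law `ν`: it reduces the mass of `[-h, h]` to at most `fl * h`. -/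
noncomputable def thinning (fl h : ℝ) (ν : Measure ℝ) : ℝ :=
  min 1 (fl * h / ν.real (Set.Icc (-h) h))

theorem thinning_nonneg {fl h : ℝ} (hfl : 0 ≤ fl) (hh : 0 ≤ h) (ν : Measure ℝ) :
    0 ≤ thinning fl h ν := le_min zero_le_one (by positivity)

theorem thinning_le_one (fl h : ℝ) (ν : Measure ℝ) : thinning fl h ν ≤ 1 := min_le_left _ _

theorem thinning_mul_le {fl h : ℝ} (hfl : 0 ≤ fl) (hh : 0 ≤ h) (ν : Measure ℝ) :
    thinning fl h ν * ν.real (Set.Icc (-h) h) ≤ fl * h := by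
  rcases (measureReal_nonneg (μ := ν) (s := Set.Icc (-h) h)).eq_or_lt with h0 | h0
  · rw [← h0, mul_zero]; positivity
  · calc _ ≤ fl * h / ν.real (Set.Icc (-h) h) * ν.real (Set.Icc (-h) h) :=
        mul_le_mul_of_nonneg_right (min_le_right _ _) h0.le
      _ = fl * h := div_mul_cancel₀ _ h0.ne'

theorem measurable_thinning {𝒳 : Type*} [MeasurableSpace 𝒳] (κ : Kernel 𝒳 ℝ) (fl h : ℝ) :
    Measurable fun x => thinning fl h (κ x) := by
  unfold thinning
  exact measurable_const.min (measurable_const.div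
    (κ.measurable_coe measurableSet_Icc).ennreal_toReal)

theorem measurable_score (α : ℝ) : Measurable (score α) := by
  unfold score
  exact measurable_const.sub (Measurable.ite measurableSet_Iio measurable_const measurable_const)

theorem measurable_hinge (h : ℝ) : Measurable fun z : ℝ × ℝ => hinge h z.1 z.2 := by
  unfold hinge
  exact Measurable.ite (measurableSet_le measurable_const measurable_fst)
    (by fun_prop) (by fun_prop)

theorem abs_score_le {α : ℝ} (h0 : 0 ≤ α) (h1 : α ≤ 1) (e : ℝ) : |score α e| ≤ 1 := by
  unfold score
  split_ifs <;> rw [abs_le] <;> constructor <;> linarith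

theorem integral_score {ν : Measure ℝ} [IsProbabilityMeasure ν] {α : ℝ}
    (h : ν.real (Set.Iio 0) = α) : ∫ e, score α e ∂ν = 0 := by
  have : score α = fun e => α - (Set.Iio (0 : ℝ)).indicator (fun _ => (1 : ℝ)) e := by
    ext e; simp [score, Set.indicator_apply]
  rw [this, integral_sub (integrable_const _)
    ((integrable_const _).indicator measurableSet_Iio), integral_indicator_const _ measurableSet_Iio]
  simp [h]

theorem integrable_score {ν : Measure ℝ} [IsFiniteMeasure ν] {α : ℝ} (h0 : 0 ≤ α) (h1 : α ≤ 1) :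
    Integrable (score α) ν :=
  (integrable_const (1 : ℝ)).mono' (measurable_score α).aestronglyMeasurable
    (ae_of_all _ fun e => abs_score_le h0 h1 e)

/-- In `exp x ≤ 1 + x + x² exp |x|` the linear term integrates to zero, because the score is
centred. -/
theorem lintegral_exp_score_le {ν : Measure ℝ} [IsProbabilityMeasure ν] {α : ℝ} (h0 : 0 ≤ α)
    (h1 : α ≤ 1) (h : ν.real (Set.Iio 0) = α) (y : ℝ) :
    ∫⁻ e, ENNReal.ofReal (Real.exp (y * score α e)) ∂ν
      ≤ ENNReal.ofReal (1 + y ^ 2 * Real.exp |y|) := by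
  refine lintegral_ofReal_exp_le (H := fun e => 1 + y ^ 2 * Real.exp |y| + y * score α e)
    ((integrable_const _).add ((integrable_score h0 h1).const_mul y)) (fun e => ?_) ?_
  · have hs := abs_score_le h0 h1 e
    have hy : |y * score α e| ≤ |y| := by
      rw [abs_mul]; exact mul_le_of_le_one_right (abs_nonneg _) hs
    have h2 : (y * score α e) ^ 2 * Real.exp |y * score α e| ≤ y ^ 2 * Real.exp |y| :=
      mul_le_mul (sq_le_sq.2 hy) (Real.exp_le_exp.2 hy) (Real.exp_pos _).le (sq_nonneg _)
    linarith [exp_le_one_add_add_sq (y * score α e)]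
  · rw [integral_add (integrable_const _) ((integrable_score h0 h1).const_mul y),
      integral_const_mul, integral_score h]
    simp

/-- Convexity of `exp` gives `exp (w y) ≤ 1 + w exp y`, so only the thinned mass of `[-h, h]`
enters. -/
theorem lintegral_exp_indicator_le {ν : Measure ℝ} [IsProbabilityMeasure ν] {w h b : ℝ}
    (hw0 : 0 ≤ w) (hw1 : w ≤ 1) (hb : w * ν.real (Set.Icc (-h) h) ≤ b) (y : ℝ) :
    ∫⁻ e, ENNReal.ofReal (Real.exp (w * (Set.Icc (-h) h).indicator (fun _ => y) e)) ∂ν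
      ≤ ENNReal.ofReal (1 + b * Real.exp y) := by
  have hi : Integrable ((Set.Icc (-h) h).indicator fun _ => w * Real.exp y) ν :=
    (integrable_const _).indicator measurableSet_Icc
  refine lintegral_ofReal_exp_le
    (H := fun e => 1 + (Set.Icc (-h) h).indicator (fun _ => w * Real.exp y) e)
    ((integrable_const _).add hi) (fun e => ?_) ?_
  · by_cases he : e ∈ Set.Icc (-h) h
    · simp only [Set.indicator_of_mem he]
      exact exp_mul_le_one_add_mul_exp hw0 hw1
    · simp [Set.indicator_of_notMem he]
  · rw [integral_add (integrable_const _) hi, integral_indicator_const _ measurableSet_Icc]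
    simp only [integral_const, probReal_univ, smul_eq_mul, one_mul]
    nlinarith [Real.exp_pos y]

/-- The mean of the hinge is bounded below through the mass of an interval of length
`min |v| h / 2` next to the origin. -/
theorem lintegral_exp_neg_hinge_le {ν : Measure ℝ} [IsProbabilityMeasure ν] {fl w h l v : ℝ}
    (hh : 0 < h) (hl : 0 ≤ l) (hw0 : 0 ≤ w) (hw1 : w ≤ 1)
    (hb : w * ν.real (Set.Icc (-h) h) ≤ fl * h)
    (hpos : ∀ c, 0 ≤ c → c ≤ h → fl * c / 6 ≤ w * ν.real (Set.Icc 0 c))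
    (hneg : ∀ c, 0 ≤ c → c ≤ h → fl * c / 6 ≤ w * ν.real (Set.Ico (-c) 0)) :
    ∫⁻ e, ENNReal.ofReal (Real.exp (-(l * (w * hinge h e v)))) ∂ν
      ≤ ENNReal.ofReal (1 - l * fl * (min |v| h) ^ 2 / 24 + l ^ 2 * h ^ 3 * fl) := by
  set c := min |v| h / 2 with hc
  have hc0 : 0 ≤ c := by have := le_min (abs_nonneg v) hh.le; positivity
  have hch : c ≤ h := by have := min_le_right |v| h; linarith
  -- `J` lies on the side of the origin given by the sign of `v`. The remainder is at least `c`
  -- there, so its weighted mean is at least `c * (fl * c / 6)`, which is `fl * (min |v| h) ^ 2 /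
  -- 24`.
  obtain ⟨J, hJm, hJ, hJh⟩ : ∃ J : Set ℝ, MeasurableSet J ∧ fl * c / 6 ≤ w * ν.real J ∧
      ∀ e ∈ J, c ≤ hinge h e v := by
    rcases le_total 0 v with hv | hv
    · refine ⟨_, measurableSet_Icc, hpos c hc0 hch, fun e he => ?_⟩
      rw [hc, abs_of_nonneg hv] at he ⊢
      exact le_hinge_of_pos he
    · refine ⟨_, measurableSet_Ico, hneg c hc0 hch, fun e he => ?_⟩
      rw [hc, abs_of_nonpos hv] at he ⊢
      exact le_hinge_of_neg he
  have hiB : Integrable ((Set.Icc (-h) h).indicator fun _ => l ^ 2 * h ^ 2 * w) ν :=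
    (integrable_const _).indicator measurableSet_Icc
  have hiJ : Integrable (J.indicator fun _ => l * w * c) ν := (integrable_const _).indicator hJm
  refine lintegral_ofReal_exp_le
    (H := fun e => 1 - J.indicator (fun _ => l * w * c) e
      + (Set.Icc (-h) h).indicator (fun _ => l ^ 2 * h ^ 2 * w) e)
    (((integrable_const _).sub hiJ).add hiB) (fun e => ?_) ?_
  · have h0 := hinge_nonneg h e v
    have h1 := exp_neg_le_one_sub_add_sq (x := l * (w * hinge h e v)) (by positivity)
    have h2 : J.indicator (fun _ => l * w * c) e ≤ l * (w * hinge h e v) := by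
      by_cases he : e ∈ J
      · rw [Set.indicator_of_mem he, mul_assoc]
        exact mul_le_mul_of_nonneg_left (mul_le_mul_of_nonneg_left (hJh e he) hw0) hl
      · rw [Set.indicator_of_notMem he]; positivity
    have h3 : (l * (w * hinge h e v)) ^ 2
        ≤ (Set.Icc (-h) h).indicator (fun _ => l ^ 2 * h ^ 2 * w) e := by
      -- The square is at most `w * h ^ 2` on `[-h, h]` since `w² ≤ w`; its integral is then at most
      -- `fl * h ^ 3`.
      have h4 := hinge_le hh.le e v
      by_cases he : e ∈ Set.Icc (-h) h
      · rw [Set.indicator_of_mem he] at h4 ⊢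
        rw [mul_pow, mul_pow, mul_assoc, mul_comm (h ^ 2) w]
        refine mul_le_mul_of_nonneg_left ?_ (sq_nonneg _)
        exact mul_le_mul (by nlinarith) (pow_le_pow_left₀ h0 h4 2) (sq_nonneg _) hw0
      · rw [Set.indicator_of_notMem he] at h4 ⊢
        rw [le_antisymm h4 h0]; simp
    linarith
  · rw [integral_add (f := fun e => 1 - J.indicator (fun _ => l * w * c) e)
      ((integrable_const _).sub hiJ) hiB, integral_sub (integrable_const _) hiJ,
      integral_indicator_const _ measurableSet_Icc, integral_indicator_const _ hJm]
    simp only [integral_const, probReal_univ, smul_eq_mul, one_mul]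
    have k1 := mul_le_mul_of_nonneg_left hJ (mul_nonneg hl hc0)
    have k2 := mul_le_mul_of_nonneg_left hb (by positivity : 0 ≤ l ^ 2 * h ^ 2)
    have k3 : l * fl * (min |v| h) ^ 2 / 24 = l * c * (fl * c / 6) := by rw [hc]; ring
    rw [k3]
    linarith

/-! ### Moment generating functions of the three controlled sums. -/

section MomentGeneratingFunctions

variable {𝒳 : Type*} [MeasurableSpace 𝒳] {m : Measure 𝒳} [IsProbabilityMeasure m]
  {κ : Kernel 𝒳 ℝ} [IsMarkovKernel κ] {g : 𝒳 → ℝ} {υ : ℝ}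

theorem lintegral_exp_score_mul_le (hg : Measurable g) (hυ : 0 < υ)
    (htail : ∀ s : ℝ, 0 ≤ s → m.real {x | υ * s ≤ |g x|} ≤ 2 * Real.exp (-s ^ 2 / 2))
    {α : ℝ} (h0 : 0 ≤ α) (h1 : α ≤ 1) (hα : ∀ᵐ x ∂m, (κ x).real (Set.Iio 0) = α) {l : ℝ}
    (hl0 : 0 ≤ l) (hl : l ≤ 1 / (2 * υ)) :
    ∫⁻ z, ENNReal.ofReal (Real.exp (l * (score α z.2 * g z.1))) ∂(m ⊗ₘ κ)
      ≤ ENNReal.ofReal (Real.exp (8 * υ ^ 2 * expConst * l ^ 2)) := by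
  have hint := (integrable_exp_of_tail hg hυ htail).const_mul (8 * υ ^ 2 * l ^ 2)
  refine (lintegral_compProd_exp_le (B := fun x => 1 + 8 * υ ^ 2 * l ^ 2 * Real.exp (|g x| / υ))
    (F := fun z => l * (score α z.2 * g z.1)) ?_ ((integrable_const _).add hint)
    (ae_of_all _ fun x => by positivity) ?_).trans (ENNReal.ofReal_le_ofReal ?_)
  · have := measurable_score α
    fun_prop
  · filter_upwards [hα] with x hx
    have := lintegral_exp_score_le h0 h1 hx (l * g x)
    refine le_trans (le_of_eq ?_) (this.trans (ENNReal.ofReal_le_ofReal ?_))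
    · congr! 4 with e
      ring
    -- Half of the available exponent `|g|/υ` absorbs `exp |l g|`, by `l ≤ 1/(2υ)`; the other half
    -- absorbs `g²`.
    · have a1 : |l * g x| ≤ |g x| / υ / 2 := by
        rw [abs_mul, abs_of_nonneg hl0]
        refine (mul_le_mul_of_nonneg_right hl (abs_nonneg _)).trans (le_of_eq ?_)
        field_simp
      have a2 := pow_le_factorial_mul_exp (x := |g x| / υ / 2) (by positivity) 2
      have a3 : g x ^ 2 ≤ 8 * υ ^ 2 * Real.exp (|g x| / υ / 2) := by
        rw [div_pow, div_pow, sq_abs, div_div, div_le_iff₀ (by positivity)] at a2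
        norm_num [Nat.factorial] at a2
        linarith
      have a4 : Real.exp (|g x| / υ) = Real.exp (|g x| / υ / 2) * Real.exp (|g x| / υ / 2) := by
        rw [← Real.exp_add]; ring_nf
      rw [a4, mul_pow]
      have a5 := mul_le_mul a3 (Real.exp_le_exp.2 a1) (Real.exp_pos _).le (by positivity)
      nlinarith [mul_le_mul_of_nonneg_left a5 (sq_nonneg l)]
  · rw [integral_add (integrable_const _) hint, integral_const_mul]
    simp only [integral_const, probReal_univ, smul_eq_mul, one_mul]
    have := mul_le_mul_of_nonneg_left (integral_exp_le hg hυ htail)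
      (by positivity : 0 ≤ 8 * υ ^ 2 * l ^ 2)
    have h2 := Real.add_one_le_exp (8 * υ ^ 2 * expConst * l ^ 2)
    linarith

theorem lintegral_exp_thinning_mul_le (hg : Measurable g) (hυ : 0 < υ)
    (htail : ∀ s : ℝ, 0 ≤ s → m.real {x | υ * s ≤ |g x|} ≤ 2 * Real.exp (-s ^ 2 / 2))
    {fl h : ℝ} (hfl : 0 ≤ fl) (hh : 0 ≤ h) :
    ∫⁻ z, ENNReal.ofReal (Real.exp (υ⁻¹ * (thinning fl h (κ z.1) *
        (Set.Icc (-h) h).indicator (fun _ => |g z.1|) z.2))) ∂(m ⊗ₘ κ)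
      ≤ ENNReal.ofReal (Real.exp (fl * h * expConst)) := by
  have hint := (integrable_exp_of_tail hg hυ htail).const_mul (fl * h)
  have hwm : Measurable fun z : 𝒳 × ℝ => thinning fl h (κ z.1) :=
    (measurable_thinning κ fl h).comp measurable_fst
  have hi : Measurable fun z : 𝒳 × ℝ => (Set.Icc (-h) h).indicator (fun _ => |g z.1|) z.2 := by
    have : (fun z : 𝒳 × ℝ => (Set.Icc (-h) h).indicator (fun _ => |g z.1|) z.2)
        = (Prod.snd ⁻¹' Set.Icc (-h) h).indicator fun z : 𝒳 × ℝ => |g z.1| := rfl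
    rw [this]
    exact Measurable.indicator (by fun_prop) (measurable_snd measurableSet_Icc)
  refine (lintegral_compProd_exp_le (B := fun x => 1 + fl * h * Real.exp (|g x| / υ))
    (F := fun z => υ⁻¹ * (thinning fl h (κ z.1) *
        (Set.Icc (-h) h).indicator (fun _ => |g z.1|) z.2)) (by fun_prop)
    ((integrable_const _).add hint)
    (ae_of_all _ fun x => by positivity) (ae_of_all _ fun x => ?_)).trans
    (ENNReal.ofReal_le_ofReal ?_)
  · refine le_trans (le_of_eq ?_) (lintegral_exp_indicator_le (thinning_nonneg hfl hh (κ x))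
      (thinning_le_one fl h (κ x)) (thinning_mul_le hfl hh (κ x)) (|g x| / υ))
    congr! 3 with e
    by_cases he : e ∈ Set.Icc (-h) h
    · simp only [Set.indicator_of_mem he]; congr 1; field_simp
    · simp only [Set.indicator_of_notMem he]; simp
  · rw [integral_add (integrable_const _) hint, integral_const_mul]
    simp only [integral_const, probReal_univ, smul_eq_mul, one_mul]
    have := mul_le_mul_of_nonneg_left (integral_exp_le hg hυ htail) (by positivity : 0 ≤ fl * h)
    have h2 := Real.add_one_le_exp (fl * h * expConst)
    linarith

/-- With exponent `-l`, the gain `l fl r² / 48` competes with the variance cost `l² K³ r³ fl`. The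
choice `l = 1 / (96 K³ r)` is optimal and makes the gain twice the cost. -/
theorem lintegral_exp_neg_thinning_hinge_le (hg : Measurable g) {fl K r : ℝ} (hfl : 0 ≤ fl)
    (hK : 0 < K) (hr : 0 < r) (hmom : 1 / 2 ≤ ∫ x, (min |g x| K) ^ 2 ∂m)
    (hpos : ∀ᵐ x ∂m, ∀ c, 0 ≤ c → c ≤ K * r →
      fl * c / 6 ≤ thinning fl (K * r) (κ x) * (κ x).real (Set.Icc 0 c))
    (hneg : ∀ᵐ x ∂m, ∀ c, 0 ≤ c → c ≤ K * r →
      fl * c / 6 ≤ thinning fl (K * r) (κ x) * (κ x).real (Set.Ico (-c) 0)) :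
    ∫⁻ z, ENNReal.ofReal (Real.exp (-(1 / (96 * K ^ 3 * r) * (thinning fl (K * r) (κ z.1) *
        hinge (K * r) z.2 (r * g z.1))))) ∂(m ⊗ₘ κ)
      ≤ ENNReal.ofReal (Real.exp (-(fl * r / (9216 * K ^ 3)))) := by
  set l := 1 / (96 * K ^ 3 * r) with hl
  have hl0 : 0 ≤ l := by positivity
  have hwm : Measurable fun z : 𝒳 × ℝ => thinning fl (K * r) (κ z.1) :=
    (measurable_thinning κ fl (K * r)).comp measurable_fst
  have hφm : Measurable fun z : 𝒳 × ℝ => hinge (K * r) z.2 (r * g z.1) :=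
    (measurable_hinge (K * r)).comp (by fun_prop : Measurable fun z : 𝒳 × ℝ => (z.2, r * g z.1))
  have hmin : ∀ x, min |r * g x| (K * r) = r * min |g x| K := fun x => by
    rw [abs_mul, abs_of_pos hr, mul_comm K r, mul_min_of_nonneg _ _ hr.le]
  have hint : Integrable (fun x => (min |g x| K) ^ 2) m :=
    (integrable_const (K ^ 2)).mono' (by fun_prop) (ae_of_all _ fun x => by
      rw [Real.norm_of_nonneg (sq_nonneg _)]
      exact pow_le_pow_left₀ (le_min (abs_nonneg _) hK.le) (min_le_right _ _) 2)
  have hB : Integrable (fun x => 1 + l ^ 2 * (K * r) ^ 3 * fl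
      - l * fl * r ^ 2 / 24 * (min |g x| K) ^ 2) m :=
    (integrable_const _).sub (hint.const_mul _)
  have hle : ∀ᵐ x ∂m, ∫⁻ e, ENNReal.ofReal (Real.exp (-(l * (thinning fl (K * r) (κ x) *
        hinge (K * r) e (r * g x))))) ∂κ x ≤ ENNReal.ofReal (1 + l ^ 2 * (K * r) ^ 3 * fl
      - l * fl * r ^ 2 / 24 * (min |g x| K) ^ 2) := by
    filter_upwards [hpos, hneg] with x h1 h2
    refine (lintegral_exp_neg_hinge_le (by positivity) hl0
      (thinning_nonneg hfl (by positivity) (κ x)) (thinning_le_one _ _ _)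
      (thinning_mul_le hfl (by positivity) (κ x)) h1 h2).trans (ENNReal.ofReal_le_ofReal ?_)
    rw [hmin]
    exact le_of_eq (by ring)
  have hB0 : ∀ᵐ x ∂m, 0 ≤ 1 + l ^ 2 * (K * r) ^ 3 * fl
      - l * fl * r ^ 2 / 24 * (min |g x| K) ^ 2 := by
    filter_upwards [hle] with x hx
    by_contra hcon
    -- A negative bound would force the lower integral of a positive function to vanish.
    rw [ENNReal.ofReal_of_nonpos (not_le.1 hcon).le, nonpos_iff_eq_zero,
      lintegral_eq_zero_iff (by
        have := hφm.comp (measurable_prodMk_left (x := x))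
        simp only [Function.comp_def] at this
        fun_prop)] at hx
    obtain ⟨e, he⟩ := hx.exists
    simp only [Pi.zero_apply, ENNReal.ofReal_eq_zero] at he
    exact absurd he (not_le.2 (Real.exp_pos _))
  refine (lintegral_compProd_exp_le (F := fun z => -(l * (thinning fl (K * r) (κ z.1) *
    hinge (K * r) z.2 (r * g z.1)))) (by fun_prop) hB hB0 hle).trans
    (ENNReal.ofReal_le_ofReal ?_)
  rw [integral_sub (integrable_const _) (hint.const_mul _), integral_const_mul]
  simp only [integral_const, probReal_univ, smul_eq_mul, one_mul]
  have h1 := mul_le_mul_of_nonneg_left hmom (by positivity : 0 ≤ l * fl * r ^ 2 / 24)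
  have h2 : l ^ 2 * (K * r) ^ 3 * fl = fl * r / (9216 * K ^ 3) := by rw [hl]; field_simp; ring
  have h3 : l * fl * r ^ 2 / 24 * (1 / 2) = 2 * (fl * r / (9216 * K ^ 3)) := by
    rw [hl]; field_simp; ring
  have h4 := Real.add_one_le_exp (-(fl * r / (9216 * K ^ 3)))
  linarith

end MomentGeneratingFunctions

/-! ### Choice of constants. -/

/-- The level, relative to the radius, at which linear forms of the covariate are truncated. -/
noncomputable def truncConst (υ : ℝ) : ℝ := 12 * υ ^ 3 * expConst

/-- The resolution of the net of the unit sphere. -/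
noncomputable def netConst (υ : ℝ) : ℝ :=
  min (1 / 2) (1 / (768 * υ * (expConst + 1) * truncConst υ))

/-- The exponent that compensates the cardinality of the net. -/
noncomputable def rateConst (υ : ℝ) : ℝ := 2 / netConst υ + 2

/-- The constant in the bound for the norm of the score. -/
noncomputable def scoreConst (υ : ℝ) : ℝ := 8 * υ ^ 2 * expConst + rateConst υ

/-- The constant in the estimation error bound. -/
noncomputable def radiusConst (υ : ℝ) : ℝ := 800 * scoreConst υ

/-- The square root of the constant in the sample size condition. -/
noncomputable def sampleConst (υ : ℝ) : ℝ :=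
  2 * truncConst υ * radiusConst υ + 8 * υ +
    (73728 * truncConst υ ^ 3 * rateConst υ / radiusConst υ
      + 4 * rateConst υ / (truncConst υ * radiusConst υ))

theorem expConst_pos : 0 < expConst := zero_lt_one.trans_le one_le_expConst

theorem truncConst_pos {υ : ℝ} (hυ : 0 < υ) : 0 < truncConst υ := by
  have := expConst_pos; unfold truncConst; positivity

theorem netConst_pos {υ : ℝ} (hυ : 0 < υ) : 0 < netConst υ := by
  have := expConst_pos
  have := truncConst_pos hυ
  exact lt_min (by norm_num) (by positivity)

theorem rateConst_pos {υ : ℝ} (hυ : 0 < υ) : 0 < rateConst υ := by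
  have := netConst_pos hυ; unfold rateConst; positivity

theorem scoreConst_pos {υ : ℝ} (hυ : 0 < υ) : 0 < scoreConst υ := by
  have := expConst_pos
  have := rateConst_pos hυ
  unfold scoreConst; positivity

theorem radiusConst_pos {υ : ℝ} (hυ : 0 < υ) : 0 < radiusConst υ := by
  have := scoreConst_pos hυ; unfold radiusConst; positivity

theorem sampleConst_pos {υ : ℝ} (hυ : 0 < υ) : 0 < sampleConst υ := by
  have := truncConst_pos hυ
  have := radiusConst_pos hυ
  have := rateConst_pos hυ
  unfold sampleConst; positivity

/-! ### Positivity of the increments on a sphere, with high probability. -/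

section Sphere

variable {Ω 𝒳 : Type*} [MeasurableSpace Ω] [MeasurableSpace 𝒳] {P : Measure Ω} {m : Measure 𝒳}
  [IsProbabilityMeasure m] {κ : Kernel 𝒳 ℝ} [IsMarkovKernel κ] {p n : ℕ}
  {ξ : Fin n → Ω → 𝒳 × ℝ} {G : 𝒳 → EuclideanSpace ℝ (Fin p)} {υ α fl r s : ℝ}

/-- Union bound over a finite set `N` of directions, for the three events that control the
increments of the loss on the sphere of radius `r`. -/
theorem measure_exists_sphere_nonpos_le (hξ : iIndepFun ξ P) (hm : ∀ i, AEMeasurable (ξ i) P)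
    (hlaw : ∀ i, P.map (ξ i) = m ⊗ₘ κ) (hG : Measurable G) (hυ : 0 < υ)
    (htail : ∀ u : EuclideanSpace ℝ (Fin p), ‖u‖ = 1 → ∀ s : ℝ, 0 ≤ s →
      m.real {x | υ * s ≤ |inner ℝ u (G x)|} ≤ 2 * Real.exp (-s ^ 2 / 2))
    (hvar : ∀ u : EuclideanSpace ℝ (Fin p), ‖u‖ = 1 → ∫ x, (inner ℝ u (G x)) ^ 2 ∂m = 1)
    (h0 : 0 ≤ α) (h1 : α ≤ 1) (hα : ∀ᵐ x ∂m, (κ x).real (Set.Iio 0) = α) (hfl : 0 < fl)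
    (hr : 0 < r) (hs : 0 < s) (hsυ : s ≤ 1 / (2 * υ)) (hn : 0 < n)
    (hsr : 768 * scoreConst υ * s < fl * r)
    (hpos : ∀ᵐ x ∂m, ∀ c, 0 ≤ c → c ≤ truncConst υ * r →
      fl * c / 6 ≤ thinning fl (truncConst υ * r) (κ x) * (κ x).real (Set.Icc 0 c))
    (hneg : ∀ᵐ x ∂m, ∀ c, 0 ≤ c → c ≤ truncConst υ * r →
      fl * c / 6 ≤ thinning fl (truncConst υ * r) (κ x) * (κ x).real (Set.Ico (-c) 0))
    {N : Finset (EuclideanSpace ℝ (Fin p))} (hN1 : ∀ c ∈ N, ‖c‖ = 1)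
    (hN : ∀ u : EuclideanSpace ℝ (Fin p), ‖u‖ = 1 → ∃ c ∈ N, ‖u - c‖ ≤ netConst υ) :
    P {ω | ∃ δ : EuclideanSpace ℝ (Fin p), ‖δ‖ = r ∧
        ∑ i, (checkLoss α ((ξ i ω).2 - inner ℝ δ (G (ξ i ω).1)) - checkLoss α (ξ i ω).2) ≤ 0}
      ≤ N.card * (ENNReal.ofReal (Real.exp (-(rateConst υ * (n * s ^ 2))))
        + ENNReal.ofReal (Real.exp (-(n * (fl * (truncConst υ * r)))))
        + ENNReal.ofReal (Real.exp (-(n * (fl * r) / (18432 * truncConst υ ^ 3))))) := by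
  set K := truncConst υ with hK
  set C := expConst with hC
  have hC0 : 0 < C := expConst_pos
  have hK0 : 0 < K := truncConst_pos hυ
  have hη0 := netConst_pos hυ
  have hn' : (0 : ℝ) < n := Nat.cast_pos.2 hn
  have hgm : ∀ c, Measurable fun x => (inner ℝ c (G x) : ℝ) := fun c => by fun_prop
  let F1 : EuclideanSpace ℝ (Fin p) → 𝒳 × ℝ → ℝ := fun c z => s * (score α z.2 * inner ℝ c (G z.1))
  let F2 : EuclideanSpace ℝ (Fin p) → 𝒳 × ℝ → ℝ := fun c z => υ⁻¹ * (thinning fl (K * r) (κ z.1) *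
    (Set.Icc (-(K * r)) (K * r)).indicator (fun _ => |inner ℝ c (G z.1)|) z.2)
  let F3 : EuclideanSpace ℝ (Fin p) → 𝒳 × ℝ → ℝ := fun c z => -(1 / (96 * K ^ 3 * r) *
    (thinning fl (K * r) (κ z.1) * hinge (K * r) z.2 (r * inner ℝ c (G z.1))))
  have hwm : Measurable fun z : 𝒳 × ℝ => thinning fl (K * r) (κ z.1) :=
    (measurable_thinning κ fl (K * r)).comp measurable_fst
  have hF1 : ∀ c, Measurable (F1 c) := fun c => by
    have := measurable_score α
    fun_prop
  have hF2 : ∀ c, Measurable (F2 c) := fun c => by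
    have : Measurable fun z : 𝒳 × ℝ => (Set.Icc (-(K * r)) (K * r)).indicator
        (fun _ => |(inner ℝ c (G z.1) : ℝ)|) z.2 :=
      Measurable.indicator (f := fun z : 𝒳 × ℝ => |(inner ℝ c (G z.1) : ℝ)|)
        (s := Prod.snd ⁻¹' Set.Icc (-(K * r)) (K * r)) (by fun_prop)
        (measurable_snd measurableSet_Icc)
    fun_prop
  have hF3 : ∀ c, Measurable (F3 c) := fun c => by
    have := (measurable_hinge (K * r)).comp
      (by fun_prop : Measurable fun z : 𝒳 × ℝ => (z.2, r * (inner ℝ c (G z.1) : ℝ)))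
    simp only [Function.comp_def] at this
    fun_prop
  -- Each threshold leaves a margin over `n` times the log-moment bound: `rateConst υ * n s²` for
  -- the score, `n fl h` for the modulus, and half of the available decay for the remainder.
  let T1 : ℝ := n * (scoreConst υ * s ^ 2)
  let T2 : ℝ := n * (fl * (K * r) * (C + 1))
  let T3 : ℝ := -(n * (fl * r) / (18432 * K ^ 3))
  have hsub : {ω | ∃ δ : EuclideanSpace ℝ (Fin p), ‖δ‖ = r ∧
        ∑ i, (checkLoss α ((ξ i ω).2 - inner ℝ δ (G (ξ i ω).1)) - checkLoss α (ξ i ω).2) ≤ 0}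
      ⊆ ⋃ c ∈ N, ({ω | T1 ≤ ∑ i, F1 c (ξ i ω)} ∪ {ω | T2 ≤ ∑ i, F2 c (ξ i ω)})
        ∪ {ω | T3 ≤ ∑ i, F3 c (ξ i ω)} := by
    rintro ω ⟨δ, hδ, hle⟩
    by_contra hω
    simp only [Set.mem_iUnion, Set.mem_union, Set.mem_ofPred_eq, not_exists, not_or, not_le] at hω
    refine absurd hle (not_le.2 ?_)
    refine lt_of_lt_of_le ?_ (sum_checkLoss_sub_ge (h := K * r) (η := netConst υ)
      (G := fun i => G (ξ i ω).1) (e := fun i => (ξ i ω).2)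
      (w := fun i => thinning fl (K * r) (κ (ξ i ω).1))
      (L := n * (scoreConst υ * s)) (M := υ * (n * (fl * (K * r) * (C + 1))))
      (Q := n * (fl * r ^ 2) / 192) (by positivity) hr
      (fun i => thinning_nonneg hfl.le (by positivity) _) (fun i => thinning_le_one _ _ _)
      (min_le_left _ _) (by positivity) hN (fun c hc => ?_) (fun c hc => ?_) (fun c hc => ?_) hδ)
    -- Half of `Q` is reserved for each error: `a2` bounds the discretization error by `Q / 2`
    -- through the net resolution, and `a3` bounds the score term strictly by `Q / 2`.
    · have a1 : netConst υ * (768 * υ * (C + 1) * K) ≤ 1 := by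
        rw [← le_div_iff₀ (by positivity)]
        exact min_le_right _ _
      have a2 := mul_le_mul_of_nonneg_left a1 (by positivity : 0 ≤ n * (fl * r ^ 2) / 384)
      have a3 := mul_lt_mul_of_pos_left hsr (by positivity : 0 < n * r / 384)
      have a4 : 2 * (υ * (n * (fl * (K * r) * (C + 1)))) * (r * netConst υ)
          = n * (fl * r ^ 2) / 384 * (netConst υ * (768 * υ * (C + 1) * K)) := by ring
      rw [a4]
      linarith
    · have h := (hω c hc).1.1
      simp only [F1, T1, ← Finset.mul_sum] at h
      rw [show n * (scoreConst υ * s ^ 2) = s * (n * (scoreConst υ * s)) by ring] at h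
      exact (lt_of_mul_lt_mul_left h hs.le).le
    · have h := (hω c hc).1.2
      simp only [F2, T2, ← Finset.mul_sum] at h
      rw [inv_mul_lt_iff₀ hυ] at h
      exact h.le
    · have h := (hω c hc).2
      simp only [F3, T3, Finset.sum_neg_distrib, ← Finset.mul_sum] at h
      rw [neg_lt_neg_iff, one_div, lt_inv_mul_iff₀ (by positivity)] at h
      simp only [real_inner_smul_left]
      refine le_trans (le_of_eq ?_) h.le
      field_simp
      ring
  refine (measure_mono hsub).trans ((measure_biUnion_finset_le _ _).trans ?_)
  rw [← nsmul_eq_mul]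
  refine Finset.sum_le_card_nsmul _ _ _ fun c hc => ?_
  refine (measure_union_le _ _).trans (add_le_add ((measure_union_le _ _).trans (add_le_add ?_ ?_)) ?_)
  · refine (measure_sum_ge_le hξ hm hlaw (hF1 c) (lintegral_exp_score_mul_le (hgm c) hυ
      (htail c (hN1 c hc)) h0 h1 hα hs.le hsυ) T1).trans (le_of_eq ?_)
    congr 2
    simp only [T1, scoreConst]
    ring
  · refine (measure_sum_ge_le hξ hm hlaw (hF2 c) (lintegral_exp_thinning_mul_le (hgm c) hυ
      (htail c (hN1 c hc)) hfl.le (by positivity)) T2).trans (le_of_eq ?_)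
    congr 2
    simp only [T2]
    ring
  · refine (measure_sum_ge_le hξ hm hlaw (hF3 c) (lintegral_exp_neg_thinning_hinge_le (hgm c)
      hfl.le hK0 hr (half_le_integral_min_sq (hgm c) hυ (htail c (hN1 c hc)) (hvar c (hN1 c hc)))
      hpos hneg) T3).trans (le_of_eq ?_)
    congr 2
    simp only [T3]
    field_simp
    ring

/-- The four summands of `sampleConst` ensure, in order, that `h ≤ fl / (2 l₀)`, that `s ≤ 1 /
(2υ)`, and that the failure exponents of the remainder and of the modulus are at least `rateConst υ
* (p + t)`. -/
theorem measure_exists_sphere_nonpos_le_exp {l₀ t : ℝ} (hξ : iIndepFun ξ P)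
    (hm : ∀ i, AEMeasurable (ξ i) P)
    (hlaw : ∀ i, P.map (ξ i) = m ⊗ₘ κ) (hG : Measurable G) (hυ : 0 < υ)
    (htail : ∀ u : EuclideanSpace ℝ (Fin p), ‖u‖ = 1 → ∀ s : ℝ, 0 ≤ s →
      m.real {x | υ * s ≤ |inner ℝ u (G x)|} ≤ 2 * Real.exp (-s ^ 2 / 2))
    (hvar : ∀ u : EuclideanSpace ℝ (Fin p), ‖u‖ = 1 → ∫ x, (inner ℝ u (G x)) ^ 2 ∂m = 1)
    (h0 : 0 ≤ α) (h1 : α ≤ 1) (hα : ∀ᵐ x ∂m, (κ x).real (Set.Iio 0) = α) (hfl : 0 < fl)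
    (hl0 : 0 < l₀) (ht : 0 ≤ t) (hp : 0 < p) (hfl0 : fl ^ 2 ≤ 4 * l₀)
    (hpos : ∀ h, 0 < h → 2 * (l₀ * h) ≤ fl → ∀ᵐ x ∂m, ∀ c, 0 ≤ c → c ≤ h →
      fl * c / 6 ≤ thinning fl h (κ x) * (κ x).real (Set.Icc 0 c))
    (hneg : ∀ h, 0 < h → 2 * (l₀ * h) ≤ fl → ∀ᵐ x ∂m, ∀ c, 0 ≤ c → c ≤ h →
      fl * c / 6 ≤ thinning fl h (κ x) * (κ x).real (Set.Ico (-c) 0))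
    (hsize : sampleConst υ ^ 2 * l₀ ^ 2 * (fl ^ 4)⁻¹ * ((p : ℝ) + t) ≤ (n : ℝ)) :
    0 < n ∧ P {ω | ∃ δ : EuclideanSpace ℝ (Fin p),
        ‖δ‖ = radiusConst υ * fl⁻¹ * √(((p : ℝ) + t) / n) ∧
        ∑ i, (checkLoss α ((ξ i ω).2 - inner ℝ δ (G (ξ i ω).1)) - checkLoss α (ξ i ω).2) ≤ 0}
      ≤ ENNReal.ofReal (Real.exp (-t)) := by
  have hK0 := truncConst_pos hυ
  have hD0 := rateConst_pos hυ
  have hA0 := scoreConst_pos hυ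
  have hR0 := radiusConst_pos hυ
  have hq0 := sampleConst_pos hυ
  have hp1 : (1 : ℝ) ≤ p := by exact_mod_cast hp
  have hn' : (0 : ℝ) < n := lt_of_lt_of_le (by positivity) hsize
  have hn : 0 < n := by exact_mod_cast hn'
  refine ⟨hn, ?_⟩
  set s := √(((p : ℝ) + t) / n) with hs
  have hs0 : 0 < s := Real.sqrt_pos.2 (by positivity)
  have hs2 : n * s ^ 2 = p + t := by rw [hs, Real.sq_sqrt (by positivity)]; field_simp
  set q := sampleConst υ with hq
  -- The sample size condition in terms of `s`. Together with `fl² ≤ 4 l₀` it bounds `s` by a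
  -- constant, in `b2`.
  have b1 : q * l₀ * s ≤ fl ^ 2 := by
    refine le_of_sq_le_sq ?_ (by positivity)
    rw [← hs2, ← div_eq_mul_inv, div_mul_eq_mul_div, div_le_iff₀ (by positivity)] at hsize
    have : n * (q * l₀ * s) ^ 2 ≤ n * (fl ^ 2) ^ 2 := by linarith
    exact le_of_mul_le_mul_left this hn'
  have b2 : q * s ≤ 4 := by
    have : l₀ * (q * s) ≤ l₀ * 4 := by linarith
    exact le_of_mul_le_mul_left this hl0
  have q1 : 2 * truncConst υ * radiusConst υ ≤ q := by
    rw [hq, sampleConst]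
    have : 0 ≤ 8 * υ + (73728 * truncConst υ ^ 3 * rateConst υ / radiusConst υ
      + 4 * rateConst υ / (truncConst υ * radiusConst υ)) := by positivity
    linarith
  have q2 : 8 * υ ≤ q := by
    rw [hq, sampleConst]
    have : 0 ≤ 2 * truncConst υ * radiusConst υ +
      (73728 * truncConst υ ^ 3 * rateConst υ / radiusConst υ
      + 4 * rateConst υ / (truncConst υ * radiusConst υ)) := by positivity
    linarith
  have q3 : 73728 * truncConst υ ^ 3 * rateConst υ / radiusConst υ ≤ q := by
    rw [hq, sampleConst]
    have : 0 ≤ 2 * truncConst υ * radiusConst υ + 8 * υ +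
      4 * rateConst υ / (truncConst υ * radiusConst υ) := by positivity
    linarith
  have q4 : 4 * rateConst υ / (truncConst υ * radiusConst υ) ≤ q := by
    rw [hq, sampleConst]
    have : 0 ≤ 2 * truncConst υ * radiusConst υ + 8 * υ +
      73728 * truncConst υ ^ 3 * rateConst υ / radiusConst υ := by positivity
    linarith
  have r1 := (mul_le_mul_of_nonneg_right q1 (by positivity : 0 ≤ l₀ * s))
  have r2 := (mul_le_mul_of_nonneg_right q2 hs0.le).trans b2
  have r3 := (mul_le_mul_of_nonneg_right q3 hs0.le).trans b2
  have r4 := (mul_le_mul_of_nonneg_right q4 hs0.le).trans b2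
  rw [div_mul_eq_mul_div, div_le_iff₀ (by positivity)] at r3 r4
  set r := radiusConst υ * fl⁻¹ * s with hr
  have hr0 : 0 < r := by positivity
  have hflr : fl * r = radiusConst υ * s := by rw [hr]; field_simp
  have hh : 2 * (l₀ * (truncConst υ * r)) ≤ fl := by
    have : fl * (2 * (l₀ * (truncConst υ * r))) ≤ fl * fl := by
      calc _ = 2 * l₀ * truncConst υ * (fl * r) := by ring
        _ ≤ fl * fl := by rw [hflr]; linarith
    exact le_of_mul_le_mul_left this hfl
  obtain ⟨N, hN1, hN, hcard⟩ := exists_net_sphere (EuclideanSpace ℝ (Fin p)) (netConst_pos hυ)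
  have hcard' : (N.card : ℝ) ≤ Real.exp (2 / netConst υ * p) := by
    refine hcard.trans ?_
    rw [finrank_euclideanSpace_fin, mul_comm, Real.exp_nat_mul]
    have := netConst_pos hυ
    refine pow_le_pow_left₀ (by positivity) ?_ _
    rw [add_comm]; exact Real.add_one_le_exp _
  refine (measure_exists_sphere_nonpos_le hξ hm hlaw hG hυ htail hvar h0 h1 hα hfl hr0 hs0 ?_ hn ?_
    (hpos _ (by positivity) hh) (hneg _ (by positivity) hh) hN1 hN).trans ?_
  · rw [le_div_iff₀ (by positivity)]; linarith
  · rw [hflr, radiusConst]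
    have : 0 < scoreConst υ * s := by positivity
    linarith
  have e2 : rateConst υ * (n * s ^ 2) ≤ n * (fl * (truncConst υ * r)) := by
    rw [show fl * (truncConst υ * r) = truncConst υ * (fl * r) by ring, hflr]
    have : rateConst υ * s ≤ truncConst υ * radiusConst υ := by linarith
    have := mul_le_mul_of_nonneg_right this (by positivity : 0 ≤ n * s)
    linarith
  have e3 : rateConst υ * (n * s ^ 2) ≤ n * (fl * r) / (18432 * truncConst υ ^ 3) := by
    rw [hflr, le_div_iff₀ (by positivity)]
    have : 18432 * truncConst υ ^ 3 * rateConst υ * s ≤ radiusConst υ := by linarith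
    have := mul_le_mul_of_nonneg_right this (by positivity : 0 ≤ n * s)
    linarith
  set E := Real.exp (-(rateConst υ * (n * s ^ 2))) with hE
  have hE0 : 0 < E := Real.exp_pos _
  have k2 : ENNReal.ofReal (Real.exp (-(n * (fl * (truncConst υ * r))))) ≤ ENNReal.ofReal E :=
    ENNReal.ofReal_le_ofReal (Real.exp_le_exp.2 (neg_le_neg e2))
  have k3 : ENNReal.ofReal (Real.exp (-(n * (fl * r) / (18432 * truncConst υ ^ 3))))
      ≤ ENNReal.ofReal E := ENNReal.ofReal_le_ofReal (Real.exp_le_exp.2 (neg_le_neg e3))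
  calc _ ≤ N.card * (ENNReal.ofReal E + ENNReal.ofReal E + ENNReal.ofReal E) := by gcongr
    _ = ENNReal.ofReal (N.card * (E + E + E)) := by
      rw [ENNReal.ofReal_mul (Nat.cast_nonneg _), ENNReal.ofReal_natCast,
        ENNReal.ofReal_add (by positivity) hE0.le, ENNReal.ofReal_add hE0.le hE0.le]
    _ ≤ ENNReal.ofReal (Real.exp (-t)) := by
      refine ENNReal.ofReal_le_ofReal ?_
      have x1 := Real.add_one_le_exp (2 : ℝ)
      have x2 : 0 ≤ 2 / netConst υ * t := by have := netConst_pos hυ; positivity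
      -- The factor `3` is absorbed by `exp 2`, and `rateConst υ * (p + t)` dominates `(2 / netConst
      -- υ) * p + 2 + t` because `p ≥ 1`.
      calc N.card * (E + E + E) ≤ Real.exp (2 / netConst υ * p) * (Real.exp 2 * E) := by
            refine mul_le_mul hcard' ?_ (by positivity) (Real.exp_pos _).le
            nlinarith
        _ = Real.exp (2 / netConst υ * p + (2 + -(rateConst υ * (n * s ^ 2)))) := by
            rw [hE, Real.exp_add, Real.exp_add]
        _ ≤ Real.exp (-t) := by
            refine Real.exp_le_exp.2 ?_
            rw [hs2, rateConst]
            linarith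

end Sphere

/-! ### Consequences of the density and quantile assumptions. -/

/-- On an interval around the origin of half-width at most `fl / (2 l₀)`, a regular density is
comparable to a constant. -/
theorem HasRegularDensity.exists_bounds {ν : Measure ℝ} {fl l₀ : ℝ}
    (hν : HasRegularDensity ν fl l₀) {h : ℝ} (hl : 0 ≤ l₀) (hh : 2 * (l₀ * h) ≤ fl) :
    ∃ f₀, fl ≤ f₀ ∧ ∀ J ⊆ Set.Icc (-h) h, MeasurableSet J →
      f₀ / 2 * volume.real J ≤ ν.real J ∧ ν.real J ≤ 3 * f₀ / 2 * volume.real J := by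
  obtain ⟨f, hfm, hf0, rfl, -, hfl, hlip⟩ := hν
  refine ⟨f 0, hfl, fun J hJ hJm => ?_⟩
  have hb : ∀ s ∈ J, f 0 / 2 ≤ f s ∧ f s ≤ 3 * f 0 / 2 := fun s hs => by
    have h1 : |s| ≤ h := abs_le.2 (hJ hs)
    have h2 := (hlip s).trans (mul_le_mul_of_nonneg_left h1 hl)
    rw [abs_le] at h2
    constructor <;> linarith
  have hvol : volume J ≠ ⊤ := ((measure_mono hJ).trans_lt measure_Icc_lt_top).ne
  have hup : volume.withDensity (fun s => ENNReal.ofReal (f s)) J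
      ≤ ENNReal.ofReal (3 * f 0 / 2 * volume.real J) := by
    rw [withDensity_apply _ hJm, ENNReal.ofReal_mul (by linarith [hf0 0]), ofReal_measureReal hvol,
      ← setLIntegral_const]
    exact setLIntegral_mono measurable_const fun s hs => ENNReal.ofReal_le_ofReal (hb s hs).2
  have hlo : ENNReal.ofReal (f 0 / 2 * volume.real J)
      ≤ volume.withDensity (fun s => ENNReal.ofReal (f s)) J := by
    rw [withDensity_apply _ hJm, ENNReal.ofReal_mul (by linarith [hf0 0]), ofReal_measureReal hvol,
      ← setLIntegral_const]
    exact setLIntegral_mono (by fun_prop) fun s hs => ENNReal.ofReal_le_ofReal (hb s hs).1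
  have hv0 : 0 ≤ volume.real J := measureReal_nonneg
  refine ⟨?_, ENNReal.toReal_le_of_le_ofReal (mul_nonneg (by linarith [hf0 0]) hv0) hup⟩
  exact (ENNReal.ofReal_le_iff_le_toReal (hup.trans_lt ENNReal.ofReal_lt_top).ne).1 hlo

/-- Thinning does not destroy the lower bound: `J` has mass at least `f₀ c / 2` and `[-h, h]` at
most `3 f₀ h`, so the unknown density level `f₀` cancels in the ratio. -/
theorem HasRegularDensity.le_thinning_mul {ν : Measure ℝ} {fl l₀ : ℝ}
    (hν : HasRegularDensity ν fl l₀) {h c : ℝ} (hfl : 0 < fl) (hl : 0 ≤ l₀) (hh0 : 0 < h)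
    (hh : 2 * (l₀ * h) ≤ fl) {J : Set ℝ} (hJ : J ⊆ Set.Icc (-h) h) (hJm : MeasurableSet J)
    (hc : volume.real J = c) : fl * c / 6 ≤ thinning fl h ν * ν.real J := by
  obtain ⟨f₀, hf₀, hb⟩ := hν.exists_bounds hl hh
  have hc0 : 0 ≤ c := hc ▸ measureReal_nonneg
  have h1 := (hb J hJ hJm).1
  have h2 := hb (Set.Icc (-h) h) subset_rfl measurableSet_Icc
  rw [hc] at h1
  rw [Real.volume_real_Icc_of_le (by linarith)] at h2
  have hf0 : 0 < f₀ := hfl.trans_le hf₀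
  have hB : 0 < ν.real (Set.Icc (-h) h) :=
    lt_of_lt_of_le (mul_pos (by linarith) (by linarith)) h2.1
  unfold thinning
  rcases min_choice 1 (fl * h / ν.real (Set.Icc (-h) h)) with hm | hm <;> rw [hm]
  · nlinarith
  · rw [div_mul_eq_mul_div, le_div_iff₀ hB]
    calc fl * c / 6 * ν.real (Set.Icc (-h) h)
        ≤ fl * c / 6 * (3 * f₀ / 2 * (h - -h)) := mul_le_mul_of_nonneg_left h2.2 (by positivity)
      _ = fl * h * (f₀ / 2 * c) := by ring
      _ ≤ fl * h * ν.real J := mul_le_mul_of_nonneg_left h1 (by positivity)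

/-- The density is at least `fl / 2` on `[0, fl / (2 l₀)]`, and the mass of this interval cannot
exceed one. -/
theorem HasRegularDensity.sq_le {ν : Measure ℝ} [IsProbabilityMeasure ν] {fl l₀ : ℝ}
    (hν : HasRegularDensity ν fl l₀) (hfl : 0 < fl) (hl : 0 < l₀) : fl ^ 2 ≤ 4 * l₀ := by
  have hh : 2 * (l₀ * (fl / (2 * l₀))) ≤ fl := le_of_eq (by field_simp)
  have hh0 : 0 < fl / (2 * l₀) := by positivity
  obtain ⟨f₀, hf₀, hb⟩ := hν.exists_bounds hl.le hh
  have h1 := (hb (Set.Icc 0 (fl / (2 * l₀))) (Set.Icc_subset_Icc (by linarith) le_rfl)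
    measurableSet_Icc).1.trans measureReal_le_one
  rw [Real.volume_real_Icc_of_le hh0.le, sub_zero] at h1
  have h2 : fl / 2 * (fl / (2 * l₀)) ≤ 1 :=
    (mul_le_mul_of_nonneg_right (by linarith) hh0.le).trans h1
  rw [div_mul_div_comm, div_le_one (by positivity)] at h2
  linarith

theorem HasRegularDensity.measure_singleton {ν : Measure ℝ} {fl l₀ : ℝ}
    (hν : HasRegularDensity ν fl l₀) (x : ℝ) : ν {x} = 0 := by
  obtain ⟨f, -, -, rfl, -⟩ := hν
  exact withDensity_absolutelyContinuous _ _ (MeasureTheory.measure_singleton x)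

/-- A law without atom at its `α`-quantile `q` gives mass `α` to the half-line below `q`. -/
theorem measureReal_Iio_quantile {ν : Measure ℝ} [IsProbabilityMeasure ν] {α q : ℝ} (h0 : 0 < α)
    (h1 : α < 1) (hq : quantile ν α = q) (hatom : ν {q} = 0) : ν.real (Set.Iio q) = α := by
  have hne : {y : ℝ | α ≤ cdf ν y}.Nonempty :=
    ((tendsto_cdf_atTop ν).eventually (lt_mem_nhds h1)).exists.imp fun _ h => h.le
  have hbdd : BddBelow {y : ℝ | α ≤ cdf ν y} := by
    obtain ⟨z, hz⟩ := ((tendsto_cdf_atBot ν).eventually (gt_mem_nhds h0)).exists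
    refine ⟨z, fun y hy => ?_⟩
    by_contra hcon
    exact absurd (hy.trans ((monotone_cdf ν) (not_le.1 hcon).le)) (not_le.2 hz)
  -- Right continuity of the distribution function shows that the infimum defining the quantile is
  -- attained.
  have hup : α ≤ cdf ν q := by
    refine ge_of_tendsto ((cdf ν).right_continuous q |>.tendsto.mono_left
      (nhdsWithin_mono q Set.Ioi_subset_Ici_self)) ?_
    filter_upwards [self_mem_nhdsWithin] with y hy
    obtain ⟨z, hz, hzy⟩ := exists_lt_of_csInf_lt hne (show quantile ν α < y from hq ▸ hy)
    exact le_trans hz (monotone_cdf ν hzy.le)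
  have hlo : ν.real (Set.Iio q) ≤ α := by
    have hI : ν (Set.Iio q) = ENNReal.ofReal (Function.leftLim (cdf ν) q - 0) := by
      conv_lhs => rw [← measure_cdf ν]
      exact (cdf ν).measure_Iio (tendsto_cdf_atBot ν) q
    rw [sub_zero] at hI
    refine ENNReal.toReal_le_of_le_ofReal h0.le (hI.le.trans (ENNReal.ofReal_le_ofReal ?_))
    refine le_of_tendsto ((monotone_cdf ν).tendsto_leftLim q) ?_
    filter_upwards [self_mem_nhdsWithin] with y hy
    by_contra hcon
    have : quantile ν α ≤ y := csInf_le hbdd (not_le.1 hcon).le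
    rw [hq] at this
    exact absurd hy (not_lt.2 this)
  refine le_antisymm hlo (hup.trans (le_of_eq ?_))
  rw [cdf_eq_real, ← Set.Iio_union_right]
  exact measureReal_congr (union_ae_eq_left_of_ae_eq_empty (ae_eq_empty.2 hatom))

/-- The quantile assumption concerns the conditional law of `Y`, the density assumption that of `ε`.
Almost everywhere uniqueness of disintegrations identifies the second with a translate of the first.
-/
theorem condDistrib_sub_inner {Ω : Type*} [MeasurableSpace Ω] {p : ℕ} {P : Measure Ω}
    [IsProbabilityMeasure P] {X : Ω → EuclideanSpace ℝ (Fin p)} {Y : Ω → ℝ} (hX : Measurable X)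
    (hY : Measurable Y) (β : EuclideanSpace ℝ (Fin p)) :
    ∀ᵐ x ∂(P.map X), condDistrib (fun ω => Y ω - inner ℝ (X ω) β) X P x
      = (condDistrib Y X P x).map fun y => y - inner ℝ x β := by
  have hφ : Measurable fun z : EuclideanSpace ℝ (Fin p) × ℝ => z.2 - (inner ℝ z.1 β : ℝ) := by
    fun_prop
  let κ' : Kernel (EuclideanSpace ℝ (Fin p)) ℝ :=
    (Kernel.id ×ₖ condDistrib Y X P).map fun z => z.2 - (inner ℝ z.1 β : ℝ)
  have hκ' : ∀ x, κ' x = (condDistrib Y X P x).map fun y => y - (inner ℝ x β : ℝ) := fun x => by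
    rw [Kernel.map_apply _ hφ, Kernel.prod_apply, Kernel.id_apply, Measure.dirac_prod,
      Measure.map_map hφ measurable_prodMk_left]
    rfl
  have : IsMarkovKernel κ' := Kernel.IsMarkovKernel.map _ hφ
  have hjoint : P.map (fun ω => (X ω, Y ω - inner ℝ (X ω) β)) = P.map X ⊗ₘ κ' := by
    refine Measure.ext_of_lintegral _ fun F hF => ?_
    have hFφ : Measurable fun z : EuclideanSpace ℝ (Fin p) × ℝ => F (z.1, z.2 - inner ℝ z.1 β) :=
      hF.comp (measurable_fst.prodMk hφ)
    rw [lintegral_map hF (by fun_prop), Measure.lintegral_compProd hF]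
    have h1 := lintegral_map (μ := P) hFφ (hX.prodMk hY)
    rw [← compProd_map_condDistrib (X := X) hY.aemeasurable, Measure.lintegral_compProd hFφ] at h1
    rw [← h1]
    refine lintegral_congr fun x => ?_
    rw [hκ', lintegral_map (by fun_prop) (by fun_prop)]
  filter_upwards [condDistrib_ae_eq_of_measure_eq_compProd (μ := P) X
    (Y := fun ω => Y ω - inner ℝ (X ω) β) (by fun_prop) hjoint] with x hx
  rw [hx, hκ']

/-! ### Standardization of the covariates. -/

section Standardization

open scoped MatrixOrder

variable {p : ℕ} {S : Matrix (Fin p) (Fin p) ℝ}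

theorem sqrtMatrix_mul_self (hS : S.PosDef) : sqrtMatrix S * sqrtMatrix S = S :=
  CFC.sqrt_mul_sqrt_self _ hS.posSemidef.nonneg

theorem isHermitian_sqrtMatrix (S : Matrix (Fin p) (Fin p) ℝ) : (sqrtMatrix S).IsHermitian :=
  (Matrix.nonneg_iff_posSemidef.1 (CFC.sqrt_nonneg S)).isHermitian

theorem isUnit_det_sqrtMatrix (hS : S.PosDef) : IsUnit (sqrtMatrix S).det := by
  have h := hS.det_pos
  rw [← sqrtMatrix_mul_self hS, Matrix.det_mul] at h
  exact isUnit_iff_ne_zero.2 fun h0 => by simp [h0] at h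

theorem inner_toEuclideanCLM_left {A : Matrix (Fin p) (Fin p) ℝ} (hA : A.IsHermitian)
    (u v : EuclideanSpace ℝ (Fin p)) :
    inner ℝ (Matrix.toEuclideanCLM (𝕜 := ℝ) A u) v
      = inner ℝ u (Matrix.toEuclideanCLM (𝕜 := ℝ) A v) := by
  have : Matrix.toEuclideanCLM (𝕜 := ℝ) A
      = ContinuousLinearMap.adjoint (Matrix.toEuclideanCLM (𝕜 := ℝ) A) := by
    rw [← ContinuousLinearMap.star_eq_adjoint, ← map_star, Matrix.star_eq_conjTranspose, hA.eq]
  conv_lhs => rw [this]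
  exact ContinuousLinearMap.adjoint_inner_left _ _ _

theorem toEuclideanCLM_sqrt_inv (hS : S.PosDef) (x : EuclideanSpace ℝ (Fin p)) :
    Matrix.toEuclideanCLM (𝕜 := ℝ) (sqrtMatrix S)
      (Matrix.toEuclideanCLM (𝕜 := ℝ) (sqrtMatrix S)⁻¹ x) = x := by
  rw [← mul_apply_eq_comp, ← map_mul, Matrix.mul_nonsing_inv _ (isUnit_det_sqrtMatrix hS),
    map_one, one_apply_eq_self]

theorem inner_sqrt_standardized (hS : S.PosDef) (u x : EuclideanSpace ℝ (Fin p)) :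
    inner ℝ (Matrix.toEuclideanCLM (𝕜 := ℝ) (sqrtMatrix S) u)
      (Matrix.toEuclideanCLM (𝕜 := ℝ) (sqrtMatrix S)⁻¹ x) = inner ℝ u x := by
  rw [inner_toEuclideanCLM_left (isHermitian_sqrtMatrix S), toEuclideanCLM_sqrt_inv hS]

theorem integral_inner_sq {Ω : Type*} [MeasurableSpace Ω] {P : Measure Ω}
    {X : Ω → EuclideanSpace ℝ (Fin p)} (hX : MemLp X 2 P) (v : EuclideanSpace ℝ (Fin p)) :
    ∫ ω, (inner ℝ v (X ω)) ^ 2 ∂P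
      = inner ℝ v (Matrix.toEuclideanCLM (𝕜 := ℝ) (secondMoment P X) v) := by
  have hXi : ∀ i, MemLp (fun ω => X ω i) 2 P := fun i =>
    (EuclideanSpace.proj (𝕜 := ℝ) i).comp_memLp' hX
  have hint : ∀ i j, Integrable (fun ω => v i * v j * (X ω i * X ω j)) P := fun i j =>
    ((hXi i).integrable_mul (hXi j)).const_mul _
  have h1 : ∀ ω, (inner ℝ v (X ω) : ℝ) ^ 2 = ∑ i, ∑ j, v i * v j * (X ω i * X ω j) := fun ω => by
    rw [sq, PiLp.inner_apply, Finset.sum_mul_sum]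
    refine Finset.sum_congr rfl fun i _ => Finset.sum_congr rfl fun j _ => ?_
    simp
    ring
  simp only [h1]
  rw [integral_finsetSum _ fun i _ => integrable_finsetSum _ fun j _ => hint i j]
  rw [Matrix.inner_toEuclideanCLM, dotProduct]
  refine Finset.sum_congr rfl fun i _ => ?_
  rw [integral_finsetSum _ fun j _ => hint i j, Matrix.mulVec, dotProduct, Finset.mul_sum]
  refine Finset.sum_congr rfl fun j _ => ?_
  rw [integral_const_mul, secondMoment, Matrix.of_apply]
  ring

/-- Isotropy of `W`: with `v = Σ^{-1/2} u`, the integral is `vᵀ Σ v = ‖Σ^{1/2} v‖² = ‖u‖²`. -/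
theorem integral_inner_standardized_sq {Ω : Type*} [MeasurableSpace Ω] {P : Measure Ω}
    {X : Ω → EuclideanSpace ℝ (Fin p)} (hX : MemLp X 2 P) (hS : (secondMoment P X).PosDef)
    (u : EuclideanSpace ℝ (Fin p)) :
    ∫ ω, (inner ℝ u (standardized P X ω)) ^ 2 ∂P = ‖u‖ ^ 2 := by
  set v := Matrix.toEuclideanCLM (𝕜 := ℝ) (sqrtMatrix (secondMoment P X))⁻¹ u with hv
  have hu : Matrix.toEuclideanCLM (𝕜 := ℝ) (sqrtMatrix (secondMoment P X)) v = u :=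
    toEuclideanCLM_sqrt_inv hS u
  have h1 : ∀ ω, (inner ℝ u (standardized P X ω) : ℝ) = inner ℝ v (X ω) := fun ω => by
    rw [← inner_sqrt_standardized hS v, hu]; rfl
  simp only [h1]
  rw [integral_inner_sq hX]
  conv_lhs => rw [← sqrtMatrix_mul_self hS]
  rw [map_mul, mul_apply_eq_comp, ← inner_toEuclideanCLM_left (isHermitian_sqrtMatrix _),
    hu, real_inner_self_eq_norm_sq]

end Standardization

end QuantileReg

/-- `(X, Y)` is the generic covariate-response pair and `(Xs i, Ys i)`, `i < n`, is an i.i.d.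
sample of it. The constants `C₁, C₂` depend on the sub-Gaussian parameter `υ` only. The estimator
`βhat` is an arbitrary selection of minimizers, and is not assumed to be measurable; the
probability statement is made for the complementary event, as an outer measure bound. -/
theorem proposition3p2 (υ : ℝ) (hυ : 1 ≤ υ) :
    ∃ C₁ C₂ : ℝ, 0 < C₁ ∧ 0 < C₂ ∧
      ∀ (Ω : Type*) [MeasurableSpace Ω] (P : Measure Ω) [IsProbabilityMeasure P]
        (p n : ℕ) (α fl l₀ t : ℝ) (βstar : EuclideanSpace ℝ (Fin p))
        (X : Ω → EuclideanSpace ℝ (Fin p)) (Y : Ω → ℝ)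
        (Xs : Fin n → Ω → EuclideanSpace ℝ (Fin p)) (Ys : Fin n → Ω → ℝ)
        (βhat : Ω → EuclideanSpace ℝ (Fin p)),
        0 < α → α < 1 → 0 < fl → 0 < l₀ → 0 ≤ t →
        Measurable X → Measurable Y →
        iIndepFun (fun i ω => (Xs i ω, Ys i ω)) P →
        (∀ i, IdentDistrib (fun ω => (Xs i ω, Ys i ω)) (fun ω => (X ω, Y ω)) P P) →
        QuantileReg.LinearQuantileModel P X Y α βstar →
        QuantileReg.SubGaussianCovariate P X υ →
        QuantileReg.RegularConditionalDensity P X Y βstar fl l₀ →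
        (∀ᵐ ω ∂P, QuantileReg.IsQREstimate α (fun i => Xs i ω) (fun i => Ys i ω) (βhat ω)) →
        C₂ * l₀ ^ 2 * (fl ^ 4)⁻¹ * ((p : ℝ) + t) ≤ (n : ℝ) →
        P {ω | C₁ * fl⁻¹ * √(((p : ℝ) + t) / n)
              < QuantileReg.matNorm (QuantileReg.secondMoment P X) (βhat ω - βstar)}
          ≤ ENNReal.ofReal (Real.exp (-t)) := by
  open QuantileReg in
  have hυ0 : 0 < υ := zero_lt_one.trans_le hυ
  refine ⟨radiusConst υ, sampleConst υ ^ 2, radiusConst_pos hυ0, pow_pos (sampleConst_pos hυ0) 2, ?_⟩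
  intro Ω _ P _ p n α fl l₀ t βstar X Y Xs Ys βhat h0 h1 hfl hl0 ht hX hY hind hid hquant hsub hreg
    hest hsize
  have hR0 := radiusConst_pos hυ0
  -- Dimension zero is separate: the error is then `0`, whereas the union bound needs `p ≥ 1` to
  -- absorb its factor `3`.
  rcases Nat.eq_zero_or_pos p with rfl | hp
  · have hempty : {ω | radiusConst υ * fl⁻¹ * √(((0 : ℕ) + t) / n)
        < matNorm (secondMoment P X) (βhat ω - βstar)} = ∅ := by
      refine Set.eq_empty_of_forall_notMem fun ω hω => ?_
      rw [Set.mem_ofPred_eq] at hω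
      refine absurd hω (not_lt.2 ?_)
      rw [matNorm, Subsingleton.elim (βhat ω - βstar) 0, map_zero, norm_zero]
      positivity
    rw [hempty, measure_empty]
    exact zero_le
  set m := P.map X with hm
  have : IsProbabilityMeasure m := Measure.isProbabilityMeasure_map hX.aemeasurable
  set κ := condDistrib (fun ω => Y ω - inner ℝ (X ω) βstar) X P with hκ
  set R := sqrtMatrix (secondMoment P X) with hR
  let G : EuclideanSpace ℝ (Fin p) → EuclideanSpace ℝ (Fin p) :=
    fun x => Matrix.toEuclideanCLM (𝕜 := ℝ) R⁻¹ x
  have hG : Measurable G := (Matrix.toEuclideanCLM (𝕜 := ℝ) R⁻¹).continuous.measurable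
  let φ : EuclideanSpace ℝ (Fin p) × ℝ → EuclideanSpace ℝ (Fin p) × ℝ :=
    fun z => (z.1, z.2 - inner ℝ z.1 βstar)
  have hφ : Measurable φ := by fun_prop
  let ξ : Fin n → Ω → EuclideanSpace ℝ (Fin p) × ℝ := fun i ω => φ (Xs i ω, Ys i ω)
  have hξ : iIndepFun ξ P := hind.comp (fun _ => φ) fun _ => hφ
  have hξm : ∀ i, AEMeasurable (ξ i) P := fun i => hφ.comp_aemeasurable (hid i).aemeasurable_fst
  have hlaw : ∀ i, P.map (ξ i) = m ⊗ₘ κ := fun i => by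
    rw [compProd_map_condDistrib (by fun_prop)]
    exact ((hid i).comp hφ).map_eq
  have hα : ∀ᵐ x ∂m, (κ x).real (Set.Iio 0) = α := by
    filter_upwards [hquant, hreg, condDistrib_sub_inner (P := P) hX hY βstar] with x hx1 hx2 hx3
    have hs : Measurable fun y : ℝ => y - (inner ℝ x βstar : ℝ) := by fun_prop
    have hpre : (fun y : ℝ => y - (inner ℝ x βstar : ℝ)) ⁻¹' {0} = {(inner ℝ x βstar : ℝ)} := by
      ext y; simp [sub_eq_zero]
    have hpre' : (fun y : ℝ => y - (inner ℝ x βstar : ℝ)) ⁻¹' Set.Iio 0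
        = Set.Iio (inner ℝ x βstar : ℝ) := by
      ext y; simp
    have h2 := hx2.measure_singleton 0
    rw [hx3, Measure.map_apply hs (measurableSet_singleton 0), hpre] at h2
    rw [hκ, hx3, map_measureReal_apply hs measurableSet_Iio, hpre']
    exact measureReal_Iio_quantile h0 h1 hx1 h2
  have hfl0 : fl ^ 2 ≤ 4 * l₀ := by
    obtain ⟨x, hx⟩ := (show ∀ᵐ x ∂m, _ from hreg).exists
    exact hx.sq_le hfl hl0
  obtain ⟨hn, hbound⟩ := measure_exists_sphere_nonpos_le_exp (υ := υ) (G := G) (l₀ := l₀) (t := t)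
    hξ hξm hlaw hG hυ0
    (fun u hu s hs => by
      rw [hm, map_measureReal_apply hX (measurableSet_le measurable_const (by fun_prop))]
      exact hsub.tail s hs u hu)
    (fun u hu => by
      rw [hm, integral_map hX.aemeasurable (by fun_prop)]
      exact (integral_inner_standardized_sq hsub.memLp hsub.posDef u).trans (by rw [hu, one_pow]))
    h0.le h1.le hα hfl hl0 ht hp hfl0
    (fun h hh hlh => by
      filter_upwards [hreg] with x hx c hc0 hch
      exact hx.le_thinning_mul hfl hl0.le hh hlh (Set.Icc_subset_Icc (by linarith) hch)
        measurableSet_Icc (by rw [Real.volume_real_Icc_of_le hc0, sub_zero]))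
    (fun h hh hlh => by
      filter_upwards [hreg] with x hx c hc0 hch
      refine hx.le_thinning_mul hfl hl0.le hh hlh
        (fun y hy => ⟨by linarith [hy.1], by linarith [hy.2]⟩)
        measurableSet_Ico (by rw [Real.volume_real_Ico_of_le (by linarith)]; ring))
    hsize
  -- Almost sure inclusion into an event that no longer mentions `βhat`; this suffices for the outer
  -- measure without measurability of `βhat`.
  refine (measure_mono_ae ?_).trans hbound
  filter_upwards [hest] with ω hω hgt
  set r := radiusConst υ * fl⁻¹ * √(((p : ℝ) + t) / n) with hr
  have hr0 : 0 ≤ r := by positivity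
  change r < ‖Matrix.toEuclideanCLM (𝕜 := ℝ) R (βhat ω - βstar)‖ at hgt
  set a := ‖Matrix.toEuclideanCLM (𝕜 := ℝ) R (βhat ω - βstar)‖ with ha
  have ha0 : 0 < a := hr0.trans_lt hgt
  -- The point where the segment from `βstar` to `βhat ω` crosses the `Σ`-sphere of radius `r`, in
  -- standardized coordinates.
  refine ⟨Matrix.toEuclideanCLM (𝕜 := ℝ) R ((r / a) • (βhat ω - βstar)), ?_, ?_⟩
  · rw [map_smul, norm_smul, Real.norm_of_nonneg (by positivity), ← ha, div_mul_cancel₀ _ ha0.ne']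
  · refine le_trans (le_of_eq ?_) (sum_checkLoss_segment_nonpos (fun i => Xs i ω) (fun i => Ys i ω)
      βstar (βhat ω) (div_nonneg hr0 ha0.le) ((div_le_one ha0).2 hgt.le) hn hω)
    refine Finset.sum_congr rfl fun i _ => ?_
    simp only [ξ, φ, G]
    rw [inner_sqrt_standardized hsub.posDef, real_inner_comm (Xs i ω) ((r / a) • _)]
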